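/- **Notation.** Let $\mathcal E=[0,1]\times\mathbb R$. Let $\mathcal P(\mathbb R)$ be the set of Borel probability measures on $\mathbb R$ with finite second moment, with the topology of weak convergence (duality with $C_b(\mathbb R)$). Let $C_b^{1,2}(\mathcal E)$ be the set of bounded continuous $\varphi:\mathcal E\to\mathbb R$ for which $\partial_t\varphi,\partial_x\varphi,\partial_{xx}\varphi$ exist on $\mathcal E$ (one-sided in time at $t=0,1$), are continuous and vanish at infinity; write $\varphi_t=\varphi(t,\cdot)$. **Data.** Let $\mu:\mathcal E\to\mathbb R^d$, let $\Sigma$ be a function on $\mathcal E$ with values in the symmetric positive definite $d\times d$ matrices, and put $\nu=\Sigma^{-1/2}\mu$. For $z=(t,x)\in\mathcal E$ let $$\Pi_z=\{(\tilde B,\tilde A)\in\mathbb R^2:\ \tilde A\ge (\tilde B^+)^2/\|\nu(z)\|^2\}$$ (for $\nu(z)=0$ this is read as $\tilde B\le 0\le\tilde A$). Let $f:\mathcal E\times\mathbb R^2\to[0,\infty)$, and let $F:\mathcal E\times\mathbb R^2\to[0,+\infty]$ be equal to $f$ where $(\tilde B,\tilde A)\in\Pi_z$ and to $+\infty$ elsewhere.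 Let $\rho_0,\bar\rho_1\in\mathcal P(\mathbb R)$ and let $C(\cdot,\bar\rho_1):\mathcal P(\mathbb R)\to[0,\infty)$. **Primal problem.** Consider finite measures $\rho\ge0$ and finite signed measures $B,A$ on $\mathcal E$ that solve $\partial_t\rho+\partial_xB-\tfrac12\partial_{xx}A=0$ with initial law $\rho_0$ and terminal law $\rho_1$, that is, $$\int_{\mathbb R}\varphi_1\,d\rho_1-\int_{\mathbb R}\varphi_0\,d\rho_0-\int_{\mathcal E}\bigl(\partial_t\varphi\,d\rho+\partial_x\varphi\,dB+\tfrac12\partial_{xx}\varphi\,dA\bigr)=0\qquad\forall\varphi\in C_b^{1,2}(\mathcal E).\tag{FP}$$ Put $$V(\rho_0,\bar\rho_1)=\inf\Bigl\{\int_{\mathcal E}F\Bigl(t,x,\tfrac{dB}{d\rho},\tfrac{dA}{d\rho}\Bigr)d\rho+C(\rho_1,\bar\rho_1)\Bigr\},$$ the infimum being over all $(\rho,B,A)$ that satisfy (FP) with some terminal law $\rho_1\in\mathcal P(\mathbb R)$; the integral is $+\infty$ unless $B,A\ll\rho$. **Assumptions.** 1. $F$ is lower semicontinuous on $\mathcal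 E\times\mathbb R^2$, and for every $z\in\mathcal E$ the function $F(z,\cdot)$ is strictly convex on $\Pi_z$. 2. There are $m>1$ and $K>0$ with $|\tilde B|^m+|\tilde A|^m\le K(1+F(t,x,\tilde B,\tilde A))$ for all $(t,x)\in\mathcal E$ and $\tilde B,\tilde A\in\mathbb R$. 3. If $(\rho,B,A)$ satisfies (FP) for some Borel probability measure $\rho_1$ on $\mathbb R$ and $\int_{\mathcal E} F(t,x,\frac{dB}{d\rho},\frac{dA}{d\rho})\,d\rho<\infty$, then $\int_{\mathcal E}\bigl(|\frac{dB}{d\rho}|^2+|\frac{dA}{d\rho}|\bigr)d\rho<\infty$. 4. $C(\cdot,\bar\rho_1)$ is convex (along mixtures of measures) and $C(\rho_1,\bar\rho_1)=0$ if and only if $\rho_1=\bar\rho_1$. **Theorem 1 (Duality).** If, in addition, $C(\cdot,\bar\rho_1)$ is continuous, then $$V(\rho_0,\bar\rho_1)=\sup_{\varphi}\Bigl\{-C^*(-\varphi_1)-\int_{\mathbb R}\varphi_0\,d\rho_0\Bigr\},\qquad C^*(r)=\sup_{\rho_1\in\mathcal P(\mathbb R)}\Bigl\{\int_{\mathbb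 R}r\,d\rho_1-C(\rho_1,\bar\rho_1)\Bigr\}\quad(r\in C_b(\mathbb R)),$$ as elements of $[0,+\infty]$, where the supremum runs over all $\varphi\in C_b^{1,2}(\mathcal E)$ with $$\partial_t\varphi(z)+\sup_{(\tilde B,\tilde A)\in\Pi_z}\Bigl\{\partial_x\varphi(z)\,\tilde B+\tfrac12\partial_{xx}\varphi(z)\,\tilde A-F(z,\tilde B,\tilde A)\Bigr\}\le0\qquad\forall z=(t,x)\in\mathcal E.$$ If $V(\rho_0,\bar\rho_1)<\infty$, the infimum defining $V(\rho_0,\bar\rho_1)$ is attained. -/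

import Mathlib

open MeasureTheory
open scoped ENNReal NNReal BoundedContinuousFunction ZeroAtInfty MatrixOrder

noncomputable section

namespace PortfolioTransport

/-- The time-space domain `[0,1] × ℝ`. -/
abbrev TimeSpace : Type := unitInterval × ℝ

/-- Borel probability measures on `ℝ` with a finite second moment, with the topology of weak
convergence (tested against bounded continuous functions). -/
abbrev P2 : Type := {μ : ProbabilityMeasure ℝ // Integrable (fun x : ℝ => x ^ 2) (μ : Measure ℝ)}

/-- The underlying measure of an element of `P2`. -/
abbrev P2.meas (μ : P2) : Measure ℝ := ((μ : ProbabilityMeasure ℝ) : Measure ℝ)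

/-- `C_b^{1,2}([0,1] × ℝ)`: bounded continuous functions `φ` whose derivatives `∂ₜφ`, `∂ₓφ`, `∂ₓₓφ`
exist (one-sided in time at `t = 0` and `t = 1`), are continuous, and vanish at infinity. -/
structure TestFun where
  toFun : TimeSpace →ᵇ ℝ
  dt : C₀(TimeSpace, ℝ)
  dx : C₀(TimeSpace, ℝ)
  dxx : C₀(TimeSpace, ℝ)
  hasDeriv_dt : ∀ (t : unitInterval) (x : ℝ),
    HasDerivWithinAt (fun s : ℝ => toFun (Set.projIcc (0 : ℝ) 1 zero_le_one s, x)) (dt (t, x))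
      (Set.Icc 0 1) (t : ℝ)
  hasDeriv_dx : ∀ (t : unitInterval) (x : ℝ),
    HasDerivAt (fun y : ℝ => toFun (t, y)) (dx (t, x)) x
  hasDeriv_dxx : ∀ (t : unitInterval) (x : ℝ),
    HasDerivAt (fun y : ℝ => dx (t, y)) (dxx (t, x)) x

/-- The time slice `φ_t = φ(t, ·)`. -/
def TestFun.slice (φ : TestFun) (t : unitInterval) : ℝ →ᵇ ℝ :=
  φ.toFun.compContinuous ⟨fun x : ℝ => (t, x), by fun_prop⟩

/-- `ν = Σ^{-1/2} μ`, computed pointwise. -/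
def marketPriceOfRisk {d : ℕ} (drift : TimeSpace → EuclideanSpace ℝ (Fin d))
    (cov : TimeSpace → Matrix (Fin d) (Fin d) ℝ) (z : TimeSpace) : EuclideanSpace ℝ (Fin d) :=
  WithLp.toLp 2 (Matrix.mulVec (CFC.sqrt (cov z))⁻¹ (WithLp.ofLp (drift z)))

/-- The pairs `(B̃, Ã)` with `Ã ≥ (B̃⁺)² / ‖ν‖²`. The inequality is written without the division,
so that for `ν = 0` it reads `B̃ ≤ 0 ≤ Ã`. -/
def controlSet {d : ℕ} (ν : EuclideanSpace ℝ (Fin d)) : Set (ℝ × ℝ) :=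
  {p | 0 ≤ p.2 ∧ (max p.1 0) ^ 2 ≤ ‖ν‖ ^ 2 * p.2}

open Classical in
/-- The cost `F = f + δ`: equal to `f` at the admissible pairs `(B̃, Ã)`, and to `+∞` elsewhere. -/
def cost {d : ℕ} (ν : TimeSpace → EuclideanSpace ℝ (Fin d)) (f : TimeSpace → ℝ × ℝ → ℝ≥0)
    (z : TimeSpace) (p : ℝ × ℝ) : ℝ≥0∞ :=
  if p ∈ controlSet (ν z) then (f z p : ℝ≥0∞) else ⊤

/-- Coercivity: `|B̃|^m + |Ã|^m ≤ K (1 + F(t, x, B̃, Ã))` for some `m > 1` and `K > 0`. -/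
def IsCoerciveCost (F : TimeSpace → ℝ × ℝ → ℝ≥0∞) : Prop :=
  ∃ m K : ℝ, 1 < m ∧ 0 < K ∧ ∀ (z : TimeSpace) (b a : ℝ),
    ENNReal.ofReal (|b| ^ m + |a| ^ m) ≤ ENNReal.ofReal K * (1 + F z (b, a))

/-- The integral `∫ g dS` against a finite signed measure, `∫ g dS⁺ - ∫ g dS⁻`. -/
def sintegral (g : TimeSpace → ℝ) (S : SignedMeasure TimeSpace) : ℝ :=
  (∫ z, g z ∂S.toJordanDecomposition.posPart) - ∫ z, g z ∂S.toJordanDecomposition.negPart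

/-- The linear Fokker–Planck equation `∂ₜρ + ∂ₓB - ½ ∂ₓₓA = 0` on `[0,1] × ℝ` with initial law `ρ₀`
and terminal law `ρ₁`, in the weak sense:
`∫ φ₁ dρ₁ - ∫ φ₀ dρ₀ - ∫ (∂ₜφ dρ + ∂ₓφ dB + ½ ∂ₓₓφ dA) = 0` for every `φ` in `C_b^{1,2}`. The
terminal law is determined by `(ρ₀, ρ, B, A)`. -/
def FokkerPlanck (ρ₀ ρ₁ : Measure ℝ) (ρ : FiniteMeasure TimeSpace)
    (B A : SignedMeasure TimeSpace) : Prop :=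
  ∀ φ : TestFun,
    (∫ x, φ.slice 1 x ∂ρ₁) - (∫ x, φ.slice 0 x ∂ρ₀)
      - ((∫ z, φ.dt z ∂(ρ : Measure TimeSpace)) + sintegral φ.dx B
          + (1 / 2) * sintegral φ.dxx A) = 0

open Classical in
/-- `∫ F(B/ρ, A/ρ) dρ`, which is `+∞` unless `B` and `A` are absolutely continuous with respect
to `ρ`. -/
def runningCost (F : TimeSpace → ℝ × ℝ → ℝ≥0∞) (ρ : FiniteMeasure TimeSpace)
    (B A : SignedMeasure TimeSpace) : ℝ≥0∞ :=
  if B.totalVariation ≪ (ρ : Measure TimeSpace) ∧ A.totalVariation ≪ (ρ : Measure TimeSpace) then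
    ∫⁻ z, F z (B.rnDeriv (ρ : Measure TimeSpace) z, A.rnDeriv (ρ : Measure TimeSpace) z)
      ∂(ρ : Measure TimeSpace)
  else ⊤

/-- Every solution of the Fokker–Planck equation started from `ρ₀` that has a finite cost satisfies
`∫ (|B/ρ|² + |A/ρ|) dρ < ∞`. -/
def HasSquareIntegrableControls (F : TimeSpace → ℝ × ℝ → ℝ≥0∞) (ρ₀ : P2) : Prop :=
  ∀ (ρ : FiniteMeasure TimeSpace) (B A : SignedMeasure TimeSpace) (ρ₁ : ProbabilityMeasure ℝ),
    FokkerPlanck ρ₀.meas (ρ₁ : Measure ℝ) ρ B A → runningCost F ρ B A < ⊤ →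
      ∫⁻ z, ENNReal.ofReal (|B.rnDeriv (ρ : Measure TimeSpace) z| ^ 2
        + |A.rnDeriv (ρ : Measure TimeSpace) z|) ∂(ρ : Measure TimeSpace) < ⊤

/-- Convexity of a functional on `P2` along mixtures of measures. -/
def IsConvexPenalty (c : P2 → ℝ≥0) : Prop :=
  ∀ (s s' : ℝ≥0) (μ μ' κ : P2), s + s' = 1 → κ.meas = s • μ.meas + s' • μ'.meas →
    c κ ≤ s * c μ + s' * c μ'

/-- The convex conjugate `C*(r) = sup_{ρ₁} { ∫ r dρ₁ - C(ρ₁) }`, for `r` bounded continuous. -/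
def conjugate (c : P2 → ℝ≥0) (r : ℝ →ᵇ ℝ) : EReal :=
  ⨆ μ : P2, (((∫ x, r x ∂μ.meas) - (c μ : ℝ) : ℝ) : EReal)

/-- The quadruples `(ρ, B, A, ρ₁)` for which `(ρ, B, A)` solves the Fokker–Planck equation with
initial law `ρ₀`, and `ρ₁` is its terminal law. -/
def feasible (ρ₀ : P2) :
    Set (FiniteMeasure TimeSpace × SignedMeasure TimeSpace × SignedMeasure TimeSpace × P2) :=
  {q | FokkerPlanck ρ₀.meas q.2.2.2.meas q.1 q.2.1 q.2.2.1}

/-- The primal objective `∫ F(B/ρ, A/ρ) dρ + C(ρ₁)`. -/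
def objective (F : TimeSpace → ℝ × ℝ → ℝ≥0∞) (c : P2 → ℝ≥0)
    (q : FiniteMeasure TimeSpace × SignedMeasure TimeSpace × SignedMeasure TimeSpace × P2) :
    ℝ≥0∞ :=
  runningCost F q.1 q.2.1 q.2.2.1 + (c q.2.2.2 : ℝ≥0∞)

/-- The primal value `V`. -/
def primalValue (F : TimeSpace → ℝ × ℝ → ℝ≥0∞) (c : P2 → ℝ≥0) (ρ₀ : P2) : ℝ≥0∞ :=
  ⨅ q ∈ feasible ρ₀, objective F c q

/-- The Hamilton–Jacobi–Bellman inequality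
`∂ₜφ + sup_{Ã ≥ (B̃⁺)²/‖ν‖²} { ∂ₓφ B̃ + ½ ∂ₓₓφ Ã - F(B̃, Ã) } ≤ 0` at every `(t, x)`. -/
def IsHJBSubsolution {d : ℕ} (ν : TimeSpace → EuclideanSpace ℝ (Fin d))
    (F : TimeSpace → ℝ × ℝ → ℝ≥0∞) (φ : TestFun) : Prop :=
  ∀ z : TimeSpace,
    ((φ.dt z : ℝ) : EReal)
      + (⨆ p ∈ controlSet (ν z),
          ((φ.dx z * p.1 + (1 / 2) * φ.dxx z * p.2 : ℝ) : EReal) - (F z p : EReal)) ≤ 0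

/-- The dual value `sup_φ { -C*(-φ₁) - ∫ φ₀ dρ₀ }`. -/
def dualValue {d : ℕ} (ν : TimeSpace → EuclideanSpace ℝ (Fin d))
    (F : TimeSpace → ℝ × ℝ → ℝ≥0∞) (c : P2 → ℝ≥0) (ρ₀ : P2) : EReal :=
  ⨆ (φ : TestFun) (_ : IsHJBSubsolution ν F φ),
    -conjugate c (-φ.slice 1) - ((∫ x, φ.slice 0 x ∂ρ₀.meas : ℝ) : EReal)

end PortfolioTransport

end

open PortfolioTransport

open MeasureTheory
open scoped ENNReal NNReal BoundedContinuousFunction ZeroAtInfty MatrixOrder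

noncomputable section

namespace PortfolioTransport

/-! Weak duality: test (FP) against an admissible `φ`. The expression `∂ₜφ + ∂ₓφ B̃ + ½ ∂ₓₓφ Ã`
(`TestFun.generator`) lies below the cost pointwise, and the conjugate is at least its value at the
actual terminal law (`dualValue_le_objective`).

For the converse let the dual value be at most a real `D`. Perturb the dual problem by a bounded
continuous `g` on time, space and controls, weighted by a superlinear `w ≤ K (1 + F)`, and by a
terminal `r`. The perturbed problems form a convex set with nonempty interior, and above `(0, 0)`
its levels never fall below `-D`. Hahn–Banach gives multipliers `ℓ` and `L` (`exists_multipliers`).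
An interior point requires a slack `k`, which amounts to adding `k (1 - t)` to `φ`; as this is not a
test function, it is approximated by localization (`dual_bound_of_generator_sub_le`).

Both multipliers are positive, and they satisfy (FP) in the form `L φ₁ - ∫ φ₀ dρ₀ = ℓ (generator /
w)`. On functions vanishing at infinity `ℓ` is a finite measure by Riesz, and superlinearity of `w`
puts `generator / w` in that class. Slowly varying cutoffs in (FP) show that `L` loses no mass, so
`L` is a probability measure `ρ₁`. Dividing the measure of `ℓ` by `w` gives a relaxed control `π` on
time, space and controls (`exists_controlMeasure`). Disintegrating `π` over time-space and averaging
the controls preserves (FP), which is affine in them, and by Jensen does not raise the cost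
(`exists_barycentric_projection`).

Finite cost gives the integrability of Assumption 3, whence `ρ₁` has a second moment
(`FokkerPlanck.integrable_sq`). Only then is `C(ρ₁)` defined; it is recovered from affine minorants
(`IsConvexPenalty.exists_affine_minorant`). The resulting competitor has objective at most `D`, so
the choice of `D` as the dual value yields equality and attainment together. -/

open Filter Topology

/-! ### Riesz representation for positive functionals on bounded continuous functions -/

section PositiveFunctional

open scoped CompactlySupported

variable {X : Type*} [TopologicalSpace X]

/-- A compactly supported continuous function, seen as a bounded continuous function. -/
def compactlySupportedToBounded (f : C_c(X, ℝ)) : X →ᵇ ℝ :=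
  ⟨f.toContinuousMap, by
    obtain ⟨C, hC⟩ := f.hasCompactSupport.exists_bound_of_continuous f.continuous
    refine ⟨C + C, fun x y => ?_⟩
    rw [dist_eq_norm]
    exact (norm_sub_le _ _).trans (add_le_add (hC x) (hC y))⟩

@[simp] theorem compactlySupportedToBounded_apply (f : C_c(X, ℝ)) (x : X) :
    compactlySupportedToBounded f x = f x := rfl

/-- The restriction of a positive functional on bounded continuous functions to compactly supported
functions. -/
def restrictToCompactlySupported (ℓ : (X →ᵇ ℝ) →L[ℝ] ℝ)
    (hpos : ∀ g : X →ᵇ ℝ, (∀ x, 0 ≤ g x) → 0 ≤ ℓ g) : C_c(X, ℝ) →ₚ[ℝ] ℝ :=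
  PositiveLinearMap.mk₀
    { toFun := fun f => ℓ (compactlySupportedToBounded f)
      map_add' := fun f g => by rw [← map_add]; congr 1
      map_smul' := fun c f => by
        rw [RingHom.id_apply, ← map_smul]; congr 1 }
    (fun f hf => hpos _ fun x => hf x)

theorem restrictToCompactlySupported_apply (ℓ : (X →ᵇ ℝ) →L[ℝ] ℝ)
    (hpos : ∀ g : X →ᵇ ℝ, (∀ x, 0 ≤ g x) → 0 ≤ ℓ g) (f : C_c(X, ℝ)) :
    restrictToCompactlySupported ℓ hpos f = ℓ (compactlySupportedToBounded f) := rfl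

variable [T2Space X] [LocallyCompactSpace X] [MeasurableSpace X] [BorelSpace X]

/-- A positive functional on `C_b` is given by a finite measure on the functions that vanish at
infinity. -/
theorem exists_measure_of_positive [SigmaCompactSpace X] (ℓ : (X →ᵇ ℝ) →L[ℝ] ℝ)
    (hpos : ∀ g : X →ᵇ ℝ, (∀ x, 0 ≤ g x) → 0 ≤ ℓ g) :
    ∃ μ : Measure X, IsFiniteMeasure μ ∧
      ∀ g : X →ᵇ ℝ, Tendsto g (cocompact X) (𝓝 0) → ℓ g = ∫ x, g x ∂μ := by
  set Λ := restrictToCompactlySupported ℓ hpos with hΛ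
  have hmono : ∀ g h : X →ᵇ ℝ, (∀ x, g x ≤ h x) → ℓ g ≤ ℓ h := fun g h hgh => by
    have := hpos (h - g) fun x => by simpa using hgh x
    rw [map_sub] at this; linarith
  have hfin : IsFiniteMeasure (RealRMK.rieszMeasure Λ) := by
    refine ⟨lt_of_le_of_lt (b := ENNReal.ofReal (ℓ 1)) ?_ ENNReal.ofReal_lt_top⟩
    rw [← iUnion_compactCovering X,
      (monotone_nat_of_le_succ fun n => compactCovering_subset X n.le_succ).measure_iUnion]
    refine iSup_le fun n => ?_
    obtain ⟨f, hf1, -, hfc, hf01⟩ := exists_continuous_one_zero_of_isCompact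
      (isCompact_compactCovering X n) isClosed_empty (Set.disjoint_empty _)
    refine (RealRMK.rieszMeasure_le_of_eq_one Λ (f := ⟨f, hfc⟩) (fun x => (hf01 x).1)
      (isCompact_compactCovering X n) fun x hx => hf1 hx).trans ?_
    refine ENNReal.ofReal_le_ofReal ?_
    rw [hΛ, restrictToCompactlySupported_apply]
    exact hmono _ _ fun x => (hf01 x).2
  refine ⟨RealRMK.rieszMeasure Λ, hfin, fun g hg => ?_⟩
  set μ := RealRMK.rieszMeasure Λ
  have key : ∀ ε : ℝ, 0 < ε → |ℓ g - ∫ x, g x ∂μ| ≤ ε * (ℓ 1 + μ.real Set.univ) := by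
    intro ε hε
    -- Soft thresholding at level `ε`: the result is within `ε` of `g` and vanishes where `|g| < ε`,
    -- hence off a compact set.
    have hcpt : HasCompactSupport fun x => max (g x - ε) 0 - max (-g x - ε) 0 := by
      have hev : ∀ᶠ x in cocompact X, |g x| < ε := by
        simpa [Real.dist_eq] using hg.eventually (Metric.ball_mem_nhds 0 hε)
      obtain ⟨K, hK, hKs⟩ := mem_cocompact.1 hev
      refine HasCompactSupport.intro hK fun x hx => ?_
      have : -ε < g x ∧ g x < ε := abs_lt.1 (hKs hx)
      rw [max_eq_right (by linarith), max_eq_right (by linarith), sub_zero]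
    let f : C_c(X, ℝ) := ⟨⟨fun x => max (g x - ε) 0 - max (-g x - ε) 0, by fun_prop⟩, hcpt⟩
    have hfg : ∀ x, |g x - f x| ≤ ε := fun x => by
      change |g x - (max (g x - ε) 0 - max (-g x - ε) 0)| ≤ ε
      rw [abs_le]
      constructor <;> rcases max_cases (g x - ε) 0 with h | h <;>
        rcases max_cases (-g x - ε) 0 with h' | h' <;> linarith
    have h1 : |ℓ g - ℓ (compactlySupportedToBounded f)| ≤ ε * ℓ 1 := by
      have e : ε * ℓ 1 = ℓ (ε • 1) := by simp
      rw [← map_sub, abs_le, e, ← map_neg]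
      constructor <;> refine hmono _ _ fun x => ?_
      · simpa using (abs_le.1 (hfg x)).1
      · simpa using (abs_le.1 (hfg x)).2
    have h2 : ∫ x, f x ∂μ = ℓ (compactlySupportedToBounded f) :=
      RealRMK.integral_rieszMeasure Λ f
    have h3 : |∫ x, f x ∂μ - ∫ x, g x ∂μ| ≤ ε * μ.real Set.univ := by
      have hfi : Integrable (fun x => f x) μ := (compactlySupportedToBounded f).integrable μ
      rw [← integral_sub hfi (g.integrable μ)]
      have hn : ∀ᵐ x ∂μ, ‖f x - g x‖ ≤ ε := ae_of_all _ fun x => by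
        rw [norm_sub_rev]; exact hfg x
      exact norm_integral_le_of_norm_le_const hn
    calc |ℓ g - ∫ x, g x ∂μ|
        = |(ℓ g - ℓ (compactlySupportedToBounded f)) + (∫ x, f x ∂μ - ∫ x, g x ∂μ)| := by
          rw [h2]; ring_nf
      _ ≤ _ := (abs_add_le _ _).trans (by linarith)
  have hlim : Tendsto (fun ε : ℝ => ε * (ℓ 1 + μ.real Set.univ)) (𝓝[>] 0) (𝓝 0) := by
    have : Tendsto (fun ε : ℝ => ε * (ℓ 1 + μ.real Set.univ)) (𝓝 0)
        (𝓝 (0 * (ℓ 1 + μ.real Set.univ))) := by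
      apply Continuous.tendsto; fun_prop
    rw [zero_mul] at this
    exact this.mono_left nhdsWithin_le_nhds
  have := ge_of_tendsto hlim (eventually_nhdsWithin_of_forall fun ε hε => key ε hε)
  exact sub_eq_zero.1 (abs_nonpos_iff.1 this)

end PositiveFunctional

/-! ### Lower semicontinuous integrands from compactly supported minorants -/

section LowerSemicontinuous

variable {X : Type*} [TopologicalSpace X] [T2Space X] [LocallyCompactSpace X]
  [SecondCountableTopology X] [MeasurableSpace X] [BorelSpace X]

/-- The integral of a nonnegative lower semicontinuous function is bounded by the integrals of the
compactly supported continuous functions below it. -/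
theorem lintegral_le_of_forall_compactSupport (μ : Measure X) [IsFiniteMeasure μ] {h : X → ℝ≥0∞}
    (hh : LowerSemicontinuous h) (M : ℝ)
    (hM : ∀ g : X →ᵇ ℝ, HasCompactSupport g → (∀ x, 0 ≤ g x) →
      (∀ x, ENNReal.ofReal (g x) ≤ h x) → ∫ x, g x ∂μ ≤ M) :
    ∫⁻ x, h x ∂μ ≤ ENNReal.ofReal M := by
  let 𝓖 : Set (X →ᵇ ℝ) :=
    {g | HasCompactSupport g ∧ (∀ x, 0 ≤ g x) ∧ ∀ x, ENNReal.ofReal (g x) ≤ h x}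
  have h0 : (0 : X →ᵇ ℝ) ∈ 𝓖 := ⟨HasCompactSupport.zero, by simp, by simp⟩
  have hsup : ∀ q : ℚ, 0 ≤ q → ∀ x, ENNReal.ofReal q < h x → ∃ g ∈ 𝓖, (q : ℝ) < g x := by
    intro q hq x hx
    obtain ⟨c, hqc, hch⟩ := exists_between hx
    have hctop : c ≠ ⊤ := ne_top_of_lt hch
    have hqc' : (q : ℝ) < c.toReal :=
      (ENNReal.ofReal_lt_iff_lt_toReal (by exact_mod_cast hq) hctop).1 hqc
    have hU : IsOpen {y | c < h y} := hh.isOpen_preimage c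
    obtain ⟨f, hf1, hf0, hfc, hf01⟩ := exists_continuous_one_zero_of_isCompact
      (isCompact_singleton (x := x)) hU.isClosed_compl
      (Set.disjoint_singleton_left.2 fun hn => hn hch)
    let fb := compactlySupportedToBounded ⟨f, hfc⟩
    refine ⟨c.toReal • fb, ⟨?_, ?_, ?_⟩, ?_⟩
    · exact hfc.smul_left (f := fun _ => c.toReal)
    · exact fun y => mul_nonneg ENNReal.toReal_nonneg (hf01 y).1
    · intro y
      by_cases hy : c < h y
      · refine le_trans ?_ hy.le
        refine ENNReal.ofReal_le_of_le_toReal ?_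
        exact mul_le_of_le_one_right ENNReal.toReal_nonneg (hf01 y).2
      · have : f y = 0 := hf0 hy
        change ENNReal.ofReal (c.toReal * f y) ≤ h y
        simp [this]
    · change (q : ℝ) < c.toReal * f x
      rw [show f x = 1 from hf1 rfl, mul_one]; exact hqc'
  -- By second countability, countably many minorants already give each rational superlevel set,
  -- hence the same pointwise supremum. Their running maxima then allow monotone convergence.
  have hcount : ∀ q : ℚ, ∃ T : Set 𝓖, T.Countable ∧
      (⋃ g ∈ T, {x | (q : ℝ) < g.1 x}) = ⋃ g : 𝓖, {x | (q : ℝ) < g.1 x} := fun q =>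
    TopologicalSpace.isOpen_iUnion_countable _ fun g =>
      isOpen_lt continuous_const g.1.continuous
  choose T hT hTU using hcount
  have hTc : (insert (⟨0, h0⟩ : 𝓖) (⋃ q, T q)).Countable :=
    (Set.countable_iUnion hT).insert _
  obtain ⟨e, he⟩ := hTc.exists_eq_range (Set.insert_nonempty _ _)
  let G : ℕ → X → ℝ := partialSups fun i => ⇑(e i).1
  have hGmono : Monotone G := (partialSups _).monotone
  have hGmem : ∀ n, ∃ g ∈ 𝓖, ∀ x, G n x = g x := by
    intro n
    induction n with
    | zero => exact ⟨(e 0).1, (e 0).2, fun x => by simp [G]⟩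
    | succ n ih =>
      obtain ⟨g, ⟨hgc, hg0, hgh⟩, hg⟩ := ih
      obtain ⟨hec, he0, heh⟩ := (e (n + 1)).2
      refine ⟨g ⊔ (e (n + 1)).1, ⟨?_, ?_, ?_⟩, ?_⟩
      · refine HasCompactSupport.intro (hgc.isCompact.union hec.isCompact) fun x hx => ?_
        rw [Set.mem_union, not_or] at hx
        change max (g x) ((e (n + 1)).1 x) = 0
        rw [image_eq_zero_of_notMem_tsupport hx.1, image_eq_zero_of_notMem_tsupport hx.2,
          max_self]
      · exact fun x => le_max_of_le_left (hg0 x)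
      · intro x
        change ENNReal.ofReal (max (g x) ((e (n + 1)).1 x)) ≤ h x
        rcases max_choice (g x) ((e (n + 1)).1 x) with h | h <;> rw [h]
        exacts [hgh x, heh x]
      · intro x
        change G (n + 1) x = max (g x) ((e (n + 1)).1 x)
        rw [← hg]
        simp [G, partialSups_add_one]
  have hlim : ∀ x, h x ≤ ⨆ n, ENNReal.ofReal (G n x) := by
    intro x
    refine le_of_forall_lt fun c hc => ?_
    obtain ⟨q, hq0, hcq, hqh⟩ := ENNReal.lt_iff_exists_rat_btwn.1 hc
    obtain ⟨g, hg, hqg⟩ := hsup q hq0 x hqh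
    have hx : x ∈ ⋃ g ∈ T q, {x | (q : ℝ) < g.1 x} := by
      rw [hTU]; exact Set.mem_iUnion.2 ⟨⟨g, hg⟩, hqg⟩
    simp only [Set.mem_iUnion] at hx
    obtain ⟨g', hg'T, hg'⟩ := hx
    obtain ⟨n, hn⟩ : g' ∈ Set.range e := by
      rw [← he]; exact Set.mem_insert_of_mem _ (Set.mem_iUnion.2 ⟨q, hg'T⟩)
    refine lt_of_lt_of_le hcq (le_iSup_of_le n (ENNReal.ofReal_le_ofReal ?_))
    have h1 : (e n).1 x ≤ G n x := le_partialSups (fun i => ⇑(e i).1) n x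
    rw [hn] at h1
    exact hg'.le.trans h1
  calc ∫⁻ x, h x ∂μ ≤ ∫⁻ x, ⨆ n, ENNReal.ofReal (G n x) ∂μ := lintegral_mono hlim
    _ = ⨆ n, ∫⁻ x, ENNReal.ofReal (G n x) ∂μ := by
        refine lintegral_iSup (fun n => ?_) fun i j hij x => ENNReal.ofReal_le_ofReal (hGmono hij x)
        obtain ⟨g, -, hg⟩ := hGmem n
        simp_rw [hg]
        exact g.continuous.measurable.ennreal_ofReal
    _ ≤ ENNReal.ofReal M := by
        refine iSup_le fun n => ?_
        obtain ⟨g, ⟨hgc, hg0, hgh⟩, hg⟩ := hGmem n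
        simp_rw [hg]
        rw [← ofReal_integral_eq_lintegral_ofReal (g.integrable μ) (ae_of_all _ hg0)]
        exact ENNReal.ofReal_le_ofReal (hM g hgc hg0 hgh)

end LowerSemicontinuous

/-! ### Affine minorants of the terminal penalty -/

section Biconjugate

/-- The integrals of all bounded continuous functions against a law. -/
def P2.pairing (μ : P2) : (ℝ →ᵇ ℝ) → ℝ := fun r => ∫ x, r x ∂μ.meas

/-- A weak neighbourhood thus constrains only finitely many integrals, which makes the separation
for the penalty finite dimensional. -/
theorem P2.isInducing_pairing : IsInducing P2.pairing := by
  refine isInducing_iff_nhds.2 fun μ => ?_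
  refine le_antisymm ?_ ?_
  · rw [← tendsto_iff_comap, tendsto_pi_nhds]
    intro r
    have : Tendsto (fun ν : P2 => (ν : ProbabilityMeasure ℝ)) (𝓝 μ) (𝓝 μ.1) :=
      continuous_subtype_val.tendsto μ
    exact ProbabilityMeasure.tendsto_iff_forall_integral_tendsto.1 this r
  · have h : Tendsto (fun ν : P2 => (ν : ProbabilityMeasure ℝ))
        (comap P2.pairing (𝓝 (P2.pairing μ))) (𝓝 μ.1) := by
      refine ProbabilityMeasure.tendsto_iff_forall_integral_tendsto.2 fun r => ?_
      have hc : Tendsto P2.pairing (comap P2.pairing (𝓝 (P2.pairing μ))) (𝓝 (P2.pairing μ)) :=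
        tendsto_comap
      exact tendsto_pi_nhds.1 hc r
    exact (tendsto_iff_comap.1 h).trans (nhds_subtype _ μ).ge

/-- The mixture of two laws. -/
theorem P2.exists_mixture (s s' : ℝ≥0) (h : s + s' = 1) (μ μ' : P2) :
    ∃ κ : P2, κ.meas = s • μ.meas + s' • μ'.meas := by
  have hp : IsProbabilityMeasure (s • μ.meas + s' • μ'.meas) := ⟨by
    simp only [Measure.add_apply, Measure.smul_apply, measure_univ]
    rw [ENNReal.smul_def, ENNReal.smul_def, smul_eq_mul, smul_eq_mul, mul_one, mul_one]
    exact_mod_cast h⟩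
  refine ⟨⟨⟨_, hp⟩, ?_⟩, rfl⟩
  exact (μ.2.smul_measure ENNReal.coe_ne_top).add_measure (μ'.2.smul_measure ENNReal.coe_ne_top)

theorem P2.integral_mixture {s s' : ℝ≥0} {μ μ' κ : P2}
    (hκ : κ.meas = s • μ.meas + s' • μ'.meas) (r : ℝ →ᵇ ℝ) :
    ∫ x, r x ∂κ.meas = s * (∫ x, r x ∂μ.meas) + s' * ∫ x, r x ∂μ'.meas := by
  have h (t : ℝ≥0) (ν : P2) : Integrable r (t • ν.meas) :=
    (r.integrable ν.meas).smul_measure ENNReal.coe_ne_top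
  rw [hκ, integral_add_measure (h s μ) (h s' μ'), integral_smul_nnreal_measure,
    integral_smul_nnreal_measure]
  rfl

/-- A continuous convex penalty is a supremum of affine functionals given by bounded continuous
functions. -/
theorem IsConvexPenalty.exists_affine_minorant {c : P2 → ℝ≥0} (hconv : IsConvexPenalty c)
    (hcont : Continuous c) (μ₀ : P2) {ε : ℝ} (hε : 0 < ε) :
    ∃ (r : ℝ →ᵇ ℝ) (τ : ℝ), (∀ μ : P2, ∫ x, r x ∂μ.meas - τ ≤ c μ) ∧
      (c μ₀ : ℝ) - ε ≤ ∫ x, r x ∂μ₀.meas - τ := by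
  have hU : {μ : P2 | (c μ₀ : ℝ) - ε < c μ} ∈ 𝓝 μ₀ := by
    have : Continuous fun μ => (c μ : ℝ) := NNReal.continuous_coe.comp hcont
    exact this.tendsto μ₀ (lt_mem_nhds (by simpa using hε))
  rw [P2.isInducing_pairing.nhds_eq_comap, mem_comap] at hU
  obtain ⟨V, hV, hVU⟩ := hU
  rw [nhds_pi, mem_pi] at hV
  obtain ⟨I, hI, t, ht, htV⟩ := hV
  have hδ : ∀ r, ∃ δ > 0, Metric.ball (μ₀.pairing r) δ ⊆ t r := fun r =>
    Metric.mem_nhds_iff.1 (ht r)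
  choose δ hδ0 hδt using hδ
  have : Fintype I := hI.fintype
  classical
  -- Laws are seen only through the finitely many integrals in `I`. The box under the level `c μ₀ -
  -- ε` misses the image `A` of the epigraph, because `c` exceeds that level throughout the
  -- neighbourhood.
  let O : Set ((I → ℝ) × ℝ) :=
    (Set.univ.pi fun i : I => Metric.ball (μ₀.pairing i) (δ i)) ×ˢ Set.Iio ((c μ₀ : ℝ) - ε)
  let A : Set ((I → ℝ) × ℝ) := {q | ∃ μ : P2, (∀ i : I, q.1 i = μ.pairing i) ∧ (c μ : ℝ) ≤ q.2}
  have hOconv : Convex ℝ O :=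
    (convex_pi fun i _ => convex_ball _ _).prod (convex_Iio _)
  have hOopen : IsOpen O :=
    (isOpen_set_pi Set.finite_univ fun i _ => Metric.isOpen_ball).prod isOpen_Iio
  have hAconv : Convex ℝ A := by
    rintro q ⟨μ, hμ, hcμ⟩ q' ⟨μ', hμ', hcμ'⟩ a b ha hb hab
    lift a to ℝ≥0 using ha
    lift b to ℝ≥0 using hb
    have hab' : a + b = 1 := by exact_mod_cast hab
    obtain ⟨κ, hκ⟩ := P2.exists_mixture a b hab' μ μ'
    refine ⟨κ, fun i => ?_, ?_⟩
    · change (a : ℝ) * q.1 i + b * q'.1 i = _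
      rw [hμ, hμ']
      exact (P2.integral_mixture hκ i).symm
    · change (c κ : ℝ) ≤ a * q.2 + b * q'.2
      have h1 : (c κ : ℝ) ≤ a * c μ + b * c μ' := by exact_mod_cast hconv a b μ μ' κ hab' hκ
      have h2 := mul_le_mul_of_nonneg_left hcμ a.coe_nonneg
      have h3 := mul_le_mul_of_nonneg_left hcμ' b.coe_nonneg
      linarith
  have hdisj : Disjoint O A := by
    rw [Set.disjoint_left]
    rintro q ⟨hq1, hq2⟩ ⟨μ, hμ, hcμ⟩
    have hmem : μ ∈ {μ : P2 | (c μ₀ : ℝ) - ε < c μ} := by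
      refine hVU (htV fun r hr => hδt r ?_)
      have := hq1 ⟨r, hr⟩ trivial
      rwa [hμ] at this
    have : (c μ₀ : ℝ) - ε < c μ := hmem
    have h2 : q.2 < (c μ₀ : ℝ) - ε := hq2
    linarith
  obtain ⟨f, u, hfO, hfA⟩ := geometric_hahn_banach_open hOconv hOopen hAconv hdisj
  let e : I → ℝ := fun i => f (Pi.single i 1, 0)
  let k : ℝ := f (0, 1)
  have hf : ∀ x s, f (x, s) = ∑ i, x i * e i + s * k := by
    intro x s
    have h1 : (x, s) = (∑ i, x i • ((Pi.single i 1 : I → ℝ), (0 : ℝ)))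
        + s • ((0 : I → ℝ), (1 : ℝ)) := by
      ext j
      · simp [Prod.fst_sum, Finset.sum_apply, Pi.single_apply]
      · simp [Prod.snd_sum]
    rw [h1, map_add, map_sum, map_smul]
    simp only [map_smul, smul_eq_mul, e, k]
  let x₀ : I → ℝ := fun i => μ₀.pairing i
  have hx₀O : ∀ s < (c μ₀ : ℝ) - ε, f (x₀, s) < u := fun s hs =>
    hfO _ ⟨fun i _ => Metric.mem_ball_self (hδ0 i), hs⟩
  have hA₀ : u ≤ f (x₀, c μ₀) := hfA _ ⟨μ₀, fun i => rfl, le_rfl⟩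
  -- The vertical line through `μ₀` meets `O` below and `A` above, so the separating hyperplane is
  -- not vertical and can be solved for the last coordinate.
  have hk : 0 < k := by
    have := (hx₀O ((c μ₀ : ℝ) - ε - 1) (by linarith)).trans_le hA₀
    rw [hf, hf] at this
    nlinarith
  let r : ℝ →ᵇ ℝ := ∑ i : I, (-(e i / k)) • (i : ℝ →ᵇ ℝ)
  have hr : ∀ μ : P2, ∫ x, r x ∂μ.meas = -(∑ i : I, μ.pairing i * e i) / k := by
    intro μ
    have : ∀ x, r x = ∑ i : I, (-(e i / k)) * (i : ℝ →ᵇ ℝ) x := fun x => by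
      simp [r, BoundedContinuousFunction.coe_sum]
    simp_rw [this]
    rw [integral_finsetSum Finset.univ fun (i : I) _ =>
      ((i : ℝ →ᵇ ℝ).integrable μ.meas).const_mul (-(e i / k))]
    simp_rw [integral_const_mul]
    rw [neg_div, Finset.sum_div, ← Finset.sum_neg_distrib]
    refine Finset.sum_congr rfl fun i _ => ?_
    simp only [P2.pairing]; ring
  refine ⟨r, -u / k, fun μ => ?_, ?_⟩
  · have := hfA (fun i => μ.pairing i, c μ) ⟨μ, fun i => rfl, le_rfl⟩
    rw [hf] at this
    rw [hr, ← sub_div, div_le_iff₀ hk]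
    linarith
  · have hle : f (x₀, (c μ₀ : ℝ) - ε) ≤ u := by
      have hcl : Tendsto (fun s : ℝ => f (x₀, s)) (𝓝[<] ((c μ₀ : ℝ) - ε))
          (𝓝 (f (x₀, (c μ₀ : ℝ) - ε))) := by
        have : Continuous fun s : ℝ => f (x₀, s) := by fun_prop
        exact this.continuousWithinAt
      exact le_of_tendsto hcl (eventually_nhdsWithin_of_forall fun s hs => (hx₀O s hs).le)
    rw [hf] at hle
    rw [hr, ← sub_div, le_div_iff₀ hk]
    simp only [x₀] at hle
    linarith

end Biconjugate

/-! ### Densities, the generator, and weak duality -/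

section WeakDuality

theorem integrable_zeroAtInfty {X : Type*} [TopologicalSpace X] [MeasurableSpace X]
    [OpensMeasurableSpace X] (g : C₀(X, ℝ)) (μ : Measure X) [IsFiniteMeasure μ] : Integrable g μ :=
  g.toBCF.integrable μ

theorem integrable_zeroAtInfty_mul {X : Type*} [TopologicalSpace X] [MeasurableSpace X]
    [OpensMeasurableSpace X] (g : C₀(X, ℝ)) {μ : Measure X} {b : X → ℝ} (hb : Integrable b μ) :
    Integrable (fun z => g z * b z) μ :=
  hb.bdd_mul (c := ‖g.toBCF‖) g.continuous.measurable.aestronglyMeasurable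
    (ae_of_all _ fun x => g.toBCF.norm_coe_le_norm x)

/-- The integral against an absolutely continuous signed measure, in terms of its density. -/
theorem sintegral_eq_integral_rnDeriv {ρ : Measure TimeSpace} [IsFiniteMeasure ρ]
    {S : SignedMeasure TimeSpace} (hS : S.totalVariation ≪ ρ) (g : C₀(TimeSpace, ℝ)) :
    sintegral g S = ∫ z, g z * S.rnDeriv ρ z ∂ρ := by
  have hp : S.toJordanDecomposition.posPart ≪ ρ :=
    (Measure.le_add_right le_rfl).absolutelyContinuous.trans hS
  have hn : S.toJordanDecomposition.negPart ≪ ρ :=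
    (Measure.le_add_left le_rfl).absolutelyContinuous.trans hS
  have hi (μ : Measure TimeSpace) [IsFiniteMeasure μ] :
      Integrable (fun z => g z * (μ.rnDeriv ρ z).toReal) ρ :=
    integrable_zeroAtInfty_mul g Measure.integrable_toReal_rnDeriv
  rw [sintegral, ← integral_rnDeriv_smul hp, ← integral_rnDeriv_smul hn]
  simp_rw [SignedMeasure.rnDeriv_def, mul_sub, smul_eq_mul, mul_comm _ (g _)]
  rw [integral_sub (hi _) (hi _)]

theorem withDensityᵥ_totalVariation_absolutelyContinuous {α : Type*} [MeasurableSpace α]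
    (μ : Measure α) (b : α → ℝ) : SignedMeasure.totalVariation (μ.withDensityᵥ b) ≪ μ := by
  have := Measure.withDensityᵥ_absolutelyContinuous μ b
  rw [SignedMeasure.absolutelyContinuous_ennreal_iff] at this
  rwa [VectorMeasure.ennrealToMeasure_toENNRealVectorMeasure] at this

theorem rnDeriv_withDensityᵥ {α : Type*} [MeasurableSpace α]
    {μ : Measure α} {b : α → ℝ} (hb : Integrable b μ) :
    SignedMeasure.rnDeriv (μ.withDensityᵥ b) μ =ᵐ[μ] b :=
  (SignedMeasure.eq_rnDeriv 0 b hb (VectorMeasure.MutuallySingular.zero_left)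
    (by rw [zero_add])).symm

/-- The expression `∂ₜφ + ∂ₓφ B̃ + ½ ∂ₓₓφ Ã`. -/
def TestFun.generator (φ : TestFun) (z : TimeSpace) (p : ℝ × ℝ) : ℝ :=
  φ.dt z + φ.dx z * p.1 + 1 / 2 * φ.dxx z * p.2

/-- Controls of infinite cost contribute `-∞` to the supremum, so only finite costs `v` matter and
the extended-real inequality reduces to real ones. -/
theorem isHJBSubsolution_of_generator_le {d : ℕ} {ν : TimeSpace → EuclideanSpace ℝ (Fin d)}
    {F : TimeSpace → ℝ × ℝ → ℝ≥0∞} {φ : TestFun}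
    (h : ∀ z p (v : ℝ≥0), F z p = v → φ.generator z p ≤ v) : IsHJBSubsolution ν F φ := by
  intro z
  have hsup : (⨆ p ∈ controlSet (ν z),
      ((φ.dx z * p.1 + (1 / 2) * φ.dxx z * p.2 : ℝ) : EReal) - (F z p : EReal))
        ≤ ((-φ.dt z : ℝ) : EReal) := by
    refine iSup₂_le fun p _ => ?_
    induction hF : F z p using ENNReal.recTopCoe with
    | top => simp
    | coe v =>
      have hp := h z p v hF
      rw [TestFun.generator] at hp
      rw [EReal.coe_nnreal_eq_coe_real, ← EReal.coe_sub, EReal.coe_le_coe_iff]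
      linarith
  calc _ ≤ ((φ.dt z : ℝ) : EReal) + ((-φ.dt z : ℝ) : EReal) := by gcongr
    _ = 0 := by rw [← EReal.coe_add, add_neg_cancel, EReal.coe_zero]

theorem IsHJBSubsolution.generator_le {d : ℕ} {ν : TimeSpace → EuclideanSpace ℝ (Fin d)}
    {f : TimeSpace → ℝ × ℝ → ℝ≥0} {φ : TestFun} (h : IsHJBSubsolution ν (cost ν f) φ)
    (z : TimeSpace) (p : ℝ × ℝ) : ENNReal.ofReal (φ.generator z p) ≤ cost ν f z p := by
  by_cases hp : p ∈ controlSet (ν z)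
  · have hc : cost ν f z p = f z p := if_pos hp
    have h1 : ((φ.dt z : ℝ) : EReal) +
        (((φ.dx z * p.1 + (1 / 2) * φ.dxx z * p.2 : ℝ) : EReal) - (cost ν f z p : EReal)) ≤ 0 := by
      refine le_trans ?_ (h z)
      gcongr
      exact le_iSup₂_of_le p hp le_rfl
    rw [hc, EReal.coe_nnreal_eq_coe_real, ← EReal.coe_sub, ← EReal.coe_add,
      ← EReal.coe_zero, EReal.coe_le_coe_iff] at h1
    rw [hc, ← ENNReal.ofReal_coe_nnreal]
    refine ENNReal.ofReal_le_ofReal ?_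
    rw [TestFun.generator]
    linarith
  · rw [cost, if_neg hp]; exact le_top

theorem integrable_generator (φ : TestFun) {ρ : Measure TimeSpace} [IsFiniteMeasure ρ]
    {b a : TimeSpace → ℝ} (hb : Integrable b ρ) (ha : Integrable a ρ) :
    Integrable (fun z => φ.generator z (b z, a z)) ρ := by
  simp_rw [TestFun.generator, mul_assoc (1 / 2 : ℝ)]
  exact ((integrable_zeroAtInfty φ.dt ρ).add (integrable_zeroAtInfty_mul φ.dx hb)).add
    ((integrable_zeroAtInfty_mul φ.dxx ha).const_mul _)

theorem integral_generator (φ : TestFun) {ρ : Measure TimeSpace} [IsFiniteMeasure ρ]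
    {b a : TimeSpace → ℝ} (hb : Integrable b ρ) (ha : Integrable a ρ) :
    ∫ z, φ.generator z (b z, a z) ∂ρ
      = ∫ z, φ.dt z ∂ρ + ∫ z, φ.dx z * b z ∂ρ + 1 / 2 * ∫ z, φ.dxx z * a z ∂ρ := by
  simp_rw [TestFun.generator, mul_assoc (1 / 2 : ℝ)]
  have ht := integrable_zeroAtInfty φ.dt ρ
  have hx := integrable_zeroAtInfty_mul φ.dx hb
  have hxx := (integrable_zeroAtInfty_mul φ.dxx ha).const_mul (1 / 2)
  have e1 := integral_add (ht.add hx) hxx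
  have e2 := integral_add ht hx
  simp only [Pi.add_apply] at e1
  rw [e1, e2, integral_const_mul]

/-- The weak form of the Fokker–Planck equation in terms of the densities. -/
theorem FokkerPlanck.integral_generator_eq {ρ₀ ρ₁ : Measure ℝ} {ρ : FiniteMeasure TimeSpace}
    {B A : SignedMeasure TimeSpace} (h : FokkerPlanck ρ₀ ρ₁ ρ B A)
    (hB : B.totalVariation ≪ (ρ : Measure TimeSpace))
    (hA : A.totalVariation ≪ (ρ : Measure TimeSpace)) (φ : TestFun) :
    (∫ x, φ.slice 1 x ∂ρ₁) - ∫ x, φ.slice 0 x ∂ρ₀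
      = ∫ z, φ.generator z (B.rnDeriv ρ z, A.rnDeriv ρ z) ∂(ρ : Measure TimeSpace) := by
  have h1 := h φ
  rw [sintegral_eq_integral_rnDeriv hB, sintegral_eq_integral_rnDeriv hA] at h1
  rw [integral_generator φ (SignedMeasure.integrable_rnDeriv B _)
    (SignedMeasure.integrable_rnDeriv A _)]
  linarith

/-- (FP) turns the boundary terms of `φ` into the integral of the generator along the densities,
which the cost dominates. Bounding the conjugate below by its term at `ρ₁` supplies the penalty. -/
theorem dualValue_le_objective {d : ℕ} {ν : TimeSpace → EuclideanSpace ℝ (Fin d)}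
    {f : TimeSpace → ℝ × ℝ → ℝ≥0} (c : P2 → ℝ≥0) (ρ₀ : P2)
    {q : FiniteMeasure TimeSpace × SignedMeasure TimeSpace × SignedMeasure TimeSpace × P2}
    (hq : q ∈ feasible ρ₀) :
    dualValue ν (cost ν f) c ρ₀ ≤ (objective (cost ν f) c q : EReal) := by
  obtain ⟨ρ, B, A, ρ₁⟩ := q
  refine iSup₂_le fun φ hφ => ?_
  change _ ≤ ((runningCost (cost ν f) ρ B A + c ρ₁ : ℝ≥0∞) : EReal)
  rcases eq_or_ne (runningCost (cost ν f) ρ B A) ⊤ with htop | htop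
  · rw [htop, top_add, EReal.coe_ennreal_top]; exact le_top
  have hac : B.totalVariation ≪ (ρ : Measure TimeSpace) ∧
      A.totalVariation ≪ (ρ : Measure TimeSpace) := by
    by_contra hn; exact htop (if_neg hn)
  have hfp := FokkerPlanck.integral_generator_eq (ρ₁ := ρ₁.meas) hq hac.1 hac.2 φ
  have hrun : runningCost (cost ν f) ρ B A = ∫⁻ z, cost ν f z (B.rnDeriv ρ z, A.rnDeriv ρ z)
      ∂(ρ : Measure TimeSpace) := if_pos hac
  have hint : ∫ z, φ.generator z (B.rnDeriv ρ z, A.rnDeriv ρ z) ∂(ρ : Measure TimeSpace)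
      ≤ (runningCost (cost ν f) ρ B A).toReal := by
    rw [integral_eq_lintegral_pos_part_sub_lintegral_neg_part
      (integrable_generator φ (SignedMeasure.integrable_rnDeriv B _)
        (SignedMeasure.integrable_rnDeriv A _))]
    refine (sub_le_self _ ENNReal.toReal_nonneg).trans (ENNReal.toReal_mono htop ?_)
    rw [hrun]
    exact lintegral_mono fun z => hφ.generator_le z _
  have hconj : (((∫ x, (-φ.slice 1) x ∂ρ₁.meas) - (c ρ₁ : ℝ) : ℝ) : EReal)
      ≤ conjugate c (-φ.slice 1) := le_iSup (fun μ : P2 =>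
        (((∫ x, (-φ.slice 1) x ∂μ.meas) - (c μ : ℝ) : ℝ) : EReal)) ρ₁
  calc -conjugate c (-φ.slice 1) - ((∫ x, φ.slice 0 x ∂ρ₀.meas : ℝ) : EReal)
      ≤ -(((∫ x, (-φ.slice 1) x ∂ρ₁.meas) - (c ρ₁ : ℝ) : ℝ) : EReal)
          - ((∫ x, φ.slice 0 x ∂ρ₀.meas : ℝ) : EReal) := by
        exact EReal.sub_le_sub (EReal.neg_le_neg_iff.2 hconj) le_rfl
    _ = ((∫ z, φ.generator z (B.rnDeriv ρ z, A.rnDeriv ρ z) ∂(ρ : Measure TimeSpace)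
          + c ρ₁ : ℝ) : EReal) := by
        rw [← EReal.coe_neg, ← EReal.coe_sub, ← hfp]
        congr 1
        simp only [BoundedContinuousFunction.coe_neg, Pi.neg_apply, integral_neg]
        ring
    _ ≤ (((runningCost (cost ν f) ρ B A).toReal + c ρ₁ : ℝ) : EReal) := by
        rw [EReal.coe_le_coe_iff]; linarith
    _ = _ := by
        rw [EReal.coe_add, EReal.coe_ennreal_add, EReal.coe_ennreal_toReal htop,
          EReal.coe_nnreal_eq_coe_real]

end WeakDuality

/-! ### Localized test functions and rational cutoffs -/

section TestFunctions

/-- Linear combinations of test functions. -/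
def TestFun.linComb (s t : ℝ) (φ ψ : TestFun) : TestFun where
  toFun := s • φ.toFun + t • ψ.toFun
  dt := s • φ.dt + t • ψ.dt
  dx := s • φ.dx + t • ψ.dx
  dxx := s • φ.dxx + t • ψ.dxx
  hasDeriv_dt τ x := ((φ.hasDeriv_dt τ x).const_mul s).add ((ψ.hasDeriv_dt τ x).const_mul t)
  hasDeriv_dx τ x := ((φ.hasDeriv_dx τ x).const_mul s).add ((ψ.hasDeriv_dx τ x).const_mul t)
  hasDeriv_dxx τ x := ((φ.hasDeriv_dxx τ x).const_mul s).add ((ψ.hasDeriv_dxx τ x).const_mul t)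

theorem TestFun.linComb_generator (s t : ℝ) (φ ψ : TestFun) (z : TimeSpace) (p : ℝ × ℝ) :
    (TestFun.linComb s t φ ψ).generator z p = s * φ.generator z p + t * ψ.generator z p := by
  simp only [TestFun.generator, TestFun.linComb, ZeroAtInftyContinuousMap.coe_add,
    ZeroAtInftyContinuousMap.coe_smul, Pi.add_apply, Pi.smul_apply, smul_eq_mul]
  ring

theorem TestFun.linComb_slice (s t : ℝ) (φ ψ : TestFun) (τ : unitInterval) :
    (TestFun.linComb s t φ ψ).slice τ = s • φ.slice τ + t • ψ.slice τ := rfl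

instance : Zero TestFun where
  zero :=
    { toFun := 0
      dt := 0
      dx := 0
      dxx := 0
      hasDeriv_dt := fun _ _ => hasDerivWithinAt_const _ _ _
      hasDeriv_dx := fun _ _ => hasDerivAt_const _ _
      hasDeriv_dxx := fun _ _ => hasDerivAt_const _ _ }

theorem TestFun.zero_generator (z : TimeSpace) (p : ℝ × ℝ) : (0 : TestFun).generator z p = 0 := by
  change (0 : ℝ) + 0 * p.1 + 1 / 2 * 0 * p.2 = 0
  ring

theorem TestFun.zero_slice (τ : unitInterval) : (0 : TestFun).slice τ = 0 := rfl

theorem tendsto_snd_cocompact :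
    Tendsto (Prod.snd : TimeSpace → ℝ) (cocompact TimeSpace) (cocompact ℝ) :=
  isProperMap_iff_tendsto_cocompact.1 isProperMap_snd_of_compactSpace |>.2

/-- The product of a function of space that vanishes at infinity with a bounded function. -/
def cutoffMul (h : C₀(ℝ, ℝ)) (g : TimeSpace →ᵇ ℝ) : C₀(TimeSpace, ℝ) where
  toFun z := h z.2 * g z
  continuous_toFun := by fun_prop
  zero_at_infty' := by
    have h0 : Tendsto (fun z : TimeSpace => h z.2) (cocompact TimeSpace) (𝓝 0) :=
      h.zero_at_infty'.comp tendsto_snd_cocompact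
    refine h0.zero_mul_isBoundedUnder_le ?_
    exact isBoundedUnder_of ⟨‖g‖, fun z => g.norm_coe_le_norm z⟩

/-- A function of space that vanishes at infinity together with its first two derivatives. -/
structure SpaceCutoff where
  toFun : C₀(ℝ, ℝ)
  d1 : C₀(ℝ, ℝ)
  d2 : C₀(ℝ, ℝ)
  hasDeriv_d1 : ∀ x, HasDerivAt toFun (d1 x) x
  hasDeriv_d2 : ∀ x, HasDerivAt d1 (d2 x) x

/-- The function `(t, x) ↦ 1 - t`. -/
def remainingTime : TimeSpace →ᵇ ℝ :=
  BoundedContinuousFunction.ofNormedAddCommGroup (fun z : TimeSpace => 1 - (z.1 : ℝ))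
    (by fun_prop) 1 fun z => by
      rw [Real.norm_eq_abs, abs_of_nonneg (by linarith [z.1.2.2])]
      linarith [z.1.2.1]

/-- The function `a φ + k + c (1 - t)`. -/
def TestFun.affine (φ : TestFun) (a k c : ℝ) : TimeSpace →ᵇ ℝ :=
  a • φ.toFun + BoundedContinuousFunction.const _ k + c • remainingTime

/-- The test function `h(x) (a φ(t, x) + k + c (1 - t))`. -/
def TestFun.localize (φ : TestFun) (h : SpaceCutoff) (a k c : ℝ) : TestFun where
  toFun := (cutoffMul h.toFun (φ.affine a k c)).toBCF
  dt := cutoffMul h.toFun (a • φ.dt.toBCF - BoundedContinuousFunction.const _ c)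
  dx := cutoffMul h.d1 (φ.affine a k c) + cutoffMul h.toFun (a • φ.dx.toBCF)
  dxx := cutoffMul h.d2 (φ.affine a k c) + cutoffMul h.d1 (a • φ.dx.toBCF) +
    (cutoffMul h.d1 (a • φ.dx.toBCF) + cutoffMul h.toFun (a • φ.dxx.toBCF))
  hasDeriv_dt t x := by
    have h1 : HasDerivWithinAt
        (fun s : ℝ => ((Set.projIcc (0 : ℝ) 1 zero_le_one s : unitInterval) : ℝ))
        1 (Set.Icc 0 1) (t : ℝ) := by
      refine (hasDerivWithinAt_id _ _).congr (fun s hs => ?_) ?_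
      · rw [Set.projIcc_of_mem _ hs]; rfl
      · rw [Set.projIcc_of_mem _ t.2]; rfl
    have h2 := ((((φ.hasDeriv_dt t x).const_mul a).add_const k).add
      ((h1.const_sub 1).const_mul c)).const_mul (h.toFun x)
    refine h2.congr_deriv ?_
    change _ = h.toFun x * (a * φ.dt (t, x) - c)
    ring
  hasDeriv_dx t x := by
    have h2 := (h.hasDeriv_d1 x).mul ((((φ.hasDeriv_dx t x).const_mul a).add_const k).add_const
      (c * (1 - (t : ℝ))))
    exact h2
  hasDeriv_dxx t x := by
    have h2 := (h.hasDeriv_d2 x).mul ((((φ.hasDeriv_dx t x).const_mul a).add_const k).add_const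
      (c * (1 - (t : ℝ))))
    have h3 := (h.hasDeriv_d1 x).mul ((φ.hasDeriv_dxx t x).const_mul a)
    exact h2.add h3

theorem TestFun.localize_generator (φ : TestFun) (h : SpaceCutoff) (a k c : ℝ) (z : TimeSpace)
    (p : ℝ × ℝ) :
    (φ.localize h a k c).generator z p =
      h.toFun z.2 * (a * φ.generator z p - c)
        + h.d1 z.2 * ((a * φ.toFun z + k + c * (1 - (z.1 : ℝ))) * p.1 + a * φ.dx z * p.2)
        + 1 / 2 * h.d2 z.2 * (a * φ.toFun z + k + c * (1 - (z.1 : ℝ))) * p.2 := by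
  change h.toFun z.2 * (a * φ.dt z - c)
    + (h.d1 z.2 * (a * φ.toFun z + k + c * (1 - (z.1 : ℝ))) + h.toFun z.2 * (a * φ.dx z)) * p.1
    + 1 / 2 * (h.d2 z.2 * (a * φ.toFun z + k + c * (1 - (z.1 : ℝ))) + h.d1 z.2 * (a * φ.dx z)
      + (h.d1 z.2 * (a * φ.dx z) + h.toFun z.2 * (a * φ.dxx z))) * p.2 = _
  rw [TestFun.generator]
  ring

/-- The function `1 / (1 + κ² x²)`. -/
def invQuad (κ x : ℝ) : ℝ := (1 + κ ^ 2 * x ^ 2)⁻¹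

theorem invQuad_pos (κ x : ℝ) : 0 < invQuad κ x := by unfold invQuad; positivity

theorem invQuad_eq (κ x : ℝ) : κ ^ 2 * x ^ 2 * invQuad κ x = 1 - invQuad κ x := by
  have : (1 + κ ^ 2 * x ^ 2) * invQuad κ x = 1 := mul_inv_cancel₀ (by positivity)
  linarith

theorem invQuad_le_one (κ x : ℝ) : invQuad κ x ≤ 1 := by
  have := invQuad_eq κ x
  have h2 : 0 ≤ κ ^ 2 * x ^ 2 * invQuad κ x := mul_nonneg (by positivity) (invQuad_pos κ x).le
  linarith

theorem abs_mul_invQuad_le (κ x : ℝ) : 2 * |κ * x| * invQuad κ x ≤ 1 := by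
  have h := invQuad_eq κ x
  have h1 := sq_nonneg (|κ * x| - 1)
  have h2 := invQuad_pos κ x
  have h3 : |κ * x| ^ 2 = κ ^ 2 * x ^ 2 := by rw [sq_abs]; ring
  nlinarith [mul_nonneg h1 h2.le]

theorem continuous_invQuad (κ : ℝ) : Continuous (invQuad κ) := by
  unfold invQuad
  exact Continuous.inv₀ (by fun_prop) fun x => by positivity

theorem hasDerivAt_invQuad (κ x : ℝ) :
    HasDerivAt (invQuad κ) (-2 * κ ^ 2 * x * invQuad κ x ^ 2) x := by
  have h1 : HasDerivAt (fun x : ℝ => 1 + κ ^ 2 * x ^ 2) (κ ^ 2 * (2 * x)) x := by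
    simpa using (((hasDerivAt_pow 2 x).const_mul (κ ^ 2)).const_add 1)
  refine (h1.inv (by positivity)).congr_deriv ?_
  unfold invQuad
  rw [inv_pow, div_eq_mul_inv]
  ring

theorem tendsto_invQuad_cocompact {κ : ℝ} (hκ : κ ≠ 0) :
    Tendsto (invQuad κ) (cocompact ℝ) (𝓝 0) := by
  have h1 : Tendsto (fun x : ℝ => κ ^ 2 * ‖x‖ ^ 2) (cocompact ℝ) atTop :=
    ((tendsto_pow_atTop two_ne_zero).comp (tendsto_norm_cocompact_atTop (E := ℝ))).const_mul_atTop
      (by positivity)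
  have h2 : Tendsto (fun x : ℝ => 1 + κ ^ 2 * x ^ 2) (cocompact ℝ) atTop := by
    simp_rw [Real.norm_eq_abs, sq_abs] at h1
    exact tendsto_atTop_add_const_left _ _ h1
  exact h2.inv_tendsto_atTop

theorem tendsto_invQuad_one (x : ℝ) {κ : ℕ → ℝ} (hκ : Tendsto κ atTop (𝓝 0)) :
    Tendsto (fun n => invQuad (κ n) x) atTop (𝓝 1) := by
  have : Tendsto (fun n => (1 + κ n ^ 2 * x ^ 2)⁻¹) atTop (𝓝 (1 + 0 ^ 2 * x ^ 2)⁻¹) :=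
    (((hκ.pow 2).mul_const _).const_add 1).inv₀ (by norm_num)
  simpa [invQuad] using this

/-- A continuous function dominated by `1 / (1 + κ² x²)` vanishes at infinity. -/
def zeroAtInftyOfLeInvQuad (κ : ℝ) (hκ : κ ≠ 0) (g : ℝ → ℝ) (hg : Continuous g) (C : ℝ)
    (h : ∀ x, |g x| ≤ C * invQuad κ x) : C₀(ℝ, ℝ) where
  toFun := g
  continuous_toFun := hg
  zero_at_infty' := by
    refine squeeze_zero_norm h ?_
    simpa using (tendsto_invQuad_cocompact hκ).const_mul C

/-- The bound is relative to the cutoff itself: localization errors can then be absorbed by the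
cutoff times the cost, even where the cutoff is tiny. It follows from `2 |κ x| ≤ 1 + κ² x²`. -/
theorem abs_invQuad_d1_le {κ : ℝ} (hκ : 0 < κ) (x : ℝ) :
    |-2 * κ ^ 2 * x * invQuad κ x ^ 2| ≤ κ * invQuad κ x := by
  have h := abs_mul_invQuad_le κ x
  have h2 := invQuad_pos κ x
  rw [abs_mul, abs_of_pos hκ] at h
  rw [show -2 * κ ^ 2 * x * invQuad κ x ^ 2 = (-2 * κ ^ 2 * invQuad κ x ^ 2) * x by ring, abs_mul,
    abs_of_nonpos (by nlinarith [mul_pos (pow_pos hκ 2) (pow_pos h2 2)])]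
  have := mul_le_mul_of_nonneg_left h (mul_pos hκ h2).le
  linarith

theorem abs_invQuad_d2_le (κ x : ℝ) :
    |κ ^ 2 * invQuad κ x ^ 2 * (6 - 8 * invQuad κ x)| ≤ 6 * κ ^ 2 * invQuad κ x := by
  have h2 := invQuad_pos κ x
  have h3 := invQuad_le_one κ x
  have h4 : |6 - 8 * invQuad κ x| ≤ 6 := abs_le.2 ⟨by linarith, by linarith⟩
  rw [abs_mul, abs_of_nonneg (by positivity)]
  calc κ ^ 2 * invQuad κ x ^ 2 * |6 - 8 * invQuad κ x| ≤ κ ^ 2 * invQuad κ x ^ 2 * 6 := by gcongr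
    _ ≤ κ ^ 2 * invQuad κ x * 6 := by gcongr; nlinarith
    _ = _ := by ring

/-- The cutoff `1 / (1 + κ² x²)`. -/
def bump (κ : ℝ) (hκ : 0 < κ) : SpaceCutoff where
  toFun := zeroAtInftyOfLeInvQuad κ hκ.ne' (invQuad κ) (continuous_invQuad κ) 1 fun x => by
    rw [abs_of_pos (invQuad_pos κ x), one_mul]
  d1 := zeroAtInftyOfLeInvQuad κ hκ.ne' (fun x => -2 * κ ^ 2 * x * invQuad κ x ^ 2)
    (by have := continuous_invQuad κ; fun_prop) κ (abs_invQuad_d1_le hκ)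
  d2 := zeroAtInftyOfLeInvQuad κ hκ.ne' (fun x => κ ^ 2 * invQuad κ x ^ 2 * (6 - 8 * invQuad κ x))
    (by have := continuous_invQuad κ; fun_prop) (6 * κ ^ 2) (abs_invQuad_d2_le κ)
  hasDeriv_d1 := hasDerivAt_invQuad κ
  hasDeriv_d2 x := by
    have h := ((hasDerivAt_id x).const_mul (-2 * κ ^ 2)).mul ((hasDerivAt_invQuad κ x).pow 2)
    refine h.congr_deriv ?_
    have := invQuad_eq κ x
    change _ = κ ^ 2 * invQuad κ x ^ 2 * (6 - 8 * invQuad κ x)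
    simp only [id, Nat.cast_ofNat, Nat.add_one_sub_one, pow_one, Pi.pow_apply]
    linear_combination 8 * κ ^ 2 * invQuad κ x ^ 2 * this

theorem abs_truncSq_d1_le {κ : ℝ} (hκ : 0 < κ) (x : ℝ) :
    |2 * x * invQuad κ x ^ 2 * (2 * invQuad κ x - 1)| ≤ κ⁻¹ * invQuad κ x := by
  have h := abs_mul_invQuad_le κ x
  have h2 := invQuad_pos κ x
  have h3 := invQuad_le_one κ x
  have h4 : |2 * invQuad κ x - 1| ≤ 1 := abs_le.2 ⟨by linarith, by linarith⟩
  rw [abs_mul, abs_of_pos hκ] at h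
  have h5 : 2 * |x| * invQuad κ x ≤ κ⁻¹ := by
    rw [← one_div, le_div_iff₀ hκ]; linarith
  rw [abs_mul, show 2 * x * invQuad κ x ^ 2 = (2 * invQuad κ x ^ 2) * x by ring, abs_mul,
    abs_of_nonneg (a := 2 * invQuad κ x ^ 2) (by positivity)]
  calc 2 * invQuad κ x ^ 2 * |x| * |2 * invQuad κ x - 1|
      ≤ 2 * invQuad κ x ^ 2 * |x| * 1 := by gcongr
    _ = (2 * |x| * invQuad κ x) * invQuad κ x := by ring
    _ ≤ _ := by gcongr

theorem abs_truncSq_d2_le (κ x : ℝ) :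
    |invQuad κ x ^ 2 * (24 * invQuad κ x ^ 2 - 28 * invQuad κ x + 6)| ≤ 6 * invQuad κ x := by
  have h2 := invQuad_pos κ x
  have h3 := invQuad_le_one κ x
  have h4 : |24 * invQuad κ x ^ 2 - 28 * invQuad κ x + 6| ≤ 6 :=
    abs_le.2 ⟨by nlinarith [sq_nonneg (invQuad κ x - 7 / 12)], by nlinarith⟩
  rw [abs_mul, abs_of_nonneg (by positivity)]
  calc invQuad κ x ^ 2 * |24 * invQuad κ x ^ 2 - 28 * invQuad κ x + 6|
      ≤ invQuad κ x ^ 2 * 6 := by gcongr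
    _ ≤ invQuad κ x * 6 := by gcongr; nlinarith
    _ = _ := by ring

/-- The truncation `x² / (1 + κ² x²)²` of the square. -/
def truncSq (κ : ℝ) (hκ : 0 < κ) : SpaceCutoff where
  toFun := zeroAtInftyOfLeInvQuad κ hκ.ne' (fun x => x ^ 2 * invQuad κ x ^ 2)
    (by have := continuous_invQuad κ; fun_prop) (κ ^ 2)⁻¹ fun x => by
      have h := invQuad_eq κ x
      have h2 := invQuad_pos κ x
      rw [abs_of_nonneg (by positivity), ← div_eq_inv_mul, le_div_iff₀ (by positivity)]
      nlinarith
  d1 := zeroAtInftyOfLeInvQuad κ hκ.ne' (fun x => 2 * x * invQuad κ x ^ 2 * (2 * invQuad κ x - 1))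
    (by have := continuous_invQuad κ; fun_prop) κ⁻¹ (abs_truncSq_d1_le hκ)
  d2 := zeroAtInftyOfLeInvQuad κ hκ.ne'
    (fun x => invQuad κ x ^ 2 * (24 * invQuad κ x ^ 2 - 28 * invQuad κ x + 6))
    (by have := continuous_invQuad κ; fun_prop) 6 (abs_truncSq_d2_le κ)
  hasDeriv_d1 x := by
    have h := (hasDerivAt_pow 2 x).mul ((hasDerivAt_invQuad κ x).pow 2)
    refine h.congr_deriv ?_
    have := invQuad_eq κ x
    change _ = 2 * x * invQuad κ x ^ 2 * (2 * invQuad κ x - 1)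
    simp only [Nat.cast_ofNat, Nat.add_one_sub_one, pow_one, Pi.pow_apply]
    linear_combination -4 * x * invQuad κ x ^ 2 * this
  hasDeriv_d2 x := by
    have hu := hasDerivAt_invQuad κ x
    have h := (((hasDerivAt_id x).const_mul 2).mul (hu.pow 2)).mul ((hu.const_mul 2).sub_const 1)
    refine h.congr_deriv ?_
    have := invQuad_eq κ x
    change _ = invQuad κ x ^ 2 * (24 * invQuad κ x ^ 2 - 28 * invQuad κ x + 6)
    simp only [id, Nat.cast_ofNat, Nat.add_one_sub_one, pow_one, Pi.pow_apply, Pi.mul_apply]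
    linear_combination (-24 * invQuad κ x ^ 3 + 8 * invQuad κ x ^ 2) * this

end TestFunctions

/-! ### Superlinear weights and the dual bound with slack -/

section Multipliers

/-- A weight with superlinear growth in the control that is dominated by the cost. -/
structure IsCostWeight (F : TimeSpace → ℝ × ℝ → ℝ≥0∞) (w : ℝ × ℝ → ℝ) (K : ℝ) : Prop where
  continuous : Continuous w
  one_le : ∀ p, 1 ≤ w p
  abs_le : ∀ p, |p.1| + |p.2| ≤ 2 * w p
  tendsto : Tendsto (fun p => (1 + |p.1| + |p.2|) / w p) (cocompact (ℝ × ℝ)) (𝓝 0)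
  pos : 0 < K
  le_cost : ∀ z p (v : ℝ≥0), F z p = v → w p ≤ K * (1 + v)

theorem IsCostWeight.pos' {F : TimeSpace → ℝ × ℝ → ℝ≥0∞} {w : ℝ × ℝ → ℝ} {K : ℝ}
    (h : IsCostWeight F w K) (p : ℝ × ℝ) : 0 < w p := one_pos.trans_le (h.one_le p)

theorem IsCoerciveCost.exists_isCostWeight {F : TimeSpace → ℝ × ℝ → ℝ≥0∞}
    (hF : IsCoerciveCost F) : ∃ w K, IsCostWeight F w K := by
  obtain ⟨m, K, hm, hK, h⟩ := hF
  have hm0 : 0 < m := one_pos.trans hm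
  have habs : ∀ x : ℝ, |x| ≤ 1 + |x| ^ m := fun x => by
    rcases le_total |x| 1 with hx | hx
    · exact hx.trans (le_add_of_nonneg_right (by positivity))
    · have := Real.rpow_le_rpow_of_exponent_le hx hm.le
      rw [Real.rpow_one] at this
      linarith
  -- The constant `1 + K` comes from `1 + K (1 + v) ≤ (1 + K) (1 + v)`; superlinearity is `m > 1`.
  refine ⟨fun p => 1 + |p.1| ^ m + |p.2| ^ m, 1 + K, ⟨?_, ?_, ?_, ?_, by positivity, ?_⟩⟩
  · exact (continuous_const.add (continuous_fst.abs.rpow_const fun _ => Or.inr hm0.le)).add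
      (continuous_snd.abs.rpow_const fun _ => Or.inr hm0.le)
  · intro p
    have : 0 ≤ |p.1| ^ m + |p.2| ^ m := by positivity
    linarith
  · intro p
    have h1 := habs p.1
    have h2 := habs p.2
    have : 0 ≤ |p.1| ^ m + |p.2| ^ m := by positivity
    linarith
  · have hs : Tendsto (fun s : ℝ => s ^ (-m) + 2 * s ^ (-(m - 1))) atTop (𝓝 0) := by
      simpa using (tendsto_rpow_neg_atTop hm0).add
        ((tendsto_rpow_neg_atTop (by linarith : 0 < m - 1)).const_mul 2)
    have hn := hs.comp (tendsto_norm_cocompact_atTop (E := ℝ × ℝ))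
    refine squeeze_zero' (Eventually.of_forall fun p => by positivity) ?_ hn
    filter_upwards [(tendsto_norm_cocompact_atTop (E := ℝ × ℝ)).eventually_gt_atTop 0] with p hp
    have h1 : |p.1| ≤ ‖p‖ := norm_fst_le p
    have h2 : |p.2| ≤ ‖p‖ := norm_snd_le p
    have h3 : ‖p‖ ^ m ≤ 1 + |p.1| ^ m + |p.2| ^ m := by
      have e1 : 0 ≤ |p.1| ^ m := by positivity
      have e2 : 0 ≤ |p.2| ^ m := by positivity
      rcases max_choice ‖p.1‖ ‖p.2‖ with h | h <;> rw [Prod.norm_def, h, Real.norm_eq_abs] <;>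
        linarith
    have h4 : 0 < ‖p‖ ^ m := Real.rpow_pos_of_pos hp m
    calc (1 + |p.1| + |p.2|) / (1 + |p.1| ^ m + |p.2| ^ m)
        ≤ (1 + ‖p‖ + ‖p‖) / ‖p‖ ^ m := by gcongr
      _ = _ := by
        simp only [Function.comp]
        rw [Real.rpow_neg hp.le, show -(m - 1) = 1 + -m by ring, Real.rpow_add hp,
          Real.rpow_one, Real.rpow_neg hp.le]
        field_simp
        ring
  · intro z p v hv
    have h1 := h z p.1 p.2
    rw [Prod.mk.eta, hv, ← ENNReal.ofReal_coe_nnreal, ← ENNReal.ofReal_one,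
      ← ENNReal.ofReal_add zero_le_one v.coe_nonneg, ← ENNReal.ofReal_mul hK.le] at h1
    have h2 := (ENNReal.ofReal_le_ofReal_iff (by positivity)).1 h1
    have := v.coe_nonneg
    change 1 + |p.1| ^ m + |p.2| ^ m ≤ _
    linarith

variable {d : ℕ} {ν : TimeSpace → EuclideanSpace ℝ (Fin d)} {F : TimeSpace → ℝ × ℝ → ℝ≥0∞}
  {w : ℝ × ℝ → ℝ} {K : ℝ} {c : P2 → ℝ≥0} {ρ₀ : P2} {D : ℝ}

/-- Any real `t` above all the terms of the conjugate may replace it, so later estimates stay in the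
reals. -/
theorem dual_bound (hD : dualValue ν F c ρ₀ ≤ (D : EReal)) {φ : TestFun}
    (hφ : IsHJBSubsolution ν F φ) {t : ℝ}
    (ht : ∀ μ : P2, -(∫ x, φ.slice 1 x ∂μ.meas) - c μ ≤ t) :
    -t - ∫ x, φ.slice 0 x ∂ρ₀.meas ≤ D := by
  have h1 : -conjugate c (-φ.slice 1) - ((∫ x, φ.slice 0 x ∂ρ₀.meas : ℝ) : EReal) ≤ D :=
    (le_iSup₂ (f := fun (φ : TestFun) (_ : IsHJBSubsolution ν F φ) =>
      -conjugate c (-φ.slice 1) - ((∫ x, φ.slice 0 x ∂ρ₀.meas : ℝ) : EReal)) φ hφ).trans hD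
  have h2 : conjugate c (-φ.slice 1) ≤ (t : EReal) := by
    refine iSup_le fun μ => ?_
    rw [EReal.coe_le_coe_iff]
    have := ht μ
    simpa [integral_neg] using this
  have h3 : ((-t - ∫ x, φ.slice 0 x ∂ρ₀.meas : ℝ) : EReal) ≤ D := by
    refine le_trans ?_ h1
    rw [EReal.coe_sub, EReal.coe_neg]
    exact EReal.sub_le_sub (EReal.neg_le_neg_iff.2 h2) le_rfl
  exact_mod_cast h3

/-- The localized function `θ ((1 - η) (φ - ‖φ‖ + k (1 - t)) + η (1 - t))` satisfies the
Hamilton–Jacobi–Bellman inequality when `φ + k (1 - t)` does and the cutoff `θ` varies slowly. -/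
theorem isHJBSubsolution_localize (hw : IsCostWeight F w K) {φ : TestFun} {k : ℝ}
    (hφ : ∀ z p (v : ℝ≥0), F z p = v → φ.generator z p - k ≤ v) {η κ M : ℝ} (hη : 0 < η)
    (hη1 : η ≤ 1) (hκ : 0 < κ) (hκ1 : κ ≤ 1)
    (hM : M = 3 * (2 * ‖φ.toFun‖ + |k| + 1) + ‖φ.dx.toBCF‖) (hκη : κ * M * (2 * K) ≤ η) :
    IsHJBSubsolution ν F
      (φ.localize (bump κ hκ) (1 - η) ((1 - η) * -‖φ.toFun‖) ((1 - η) * k + η)) := by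
  refine isHJBSubsolution_of_generator_le fun z p v hv => ?_
  rw [TestFun.localize_generator]
  set H := (1 - η) * φ.toFun z + (1 - η) * -‖φ.toFun‖ + ((1 - η) * k + η) * (1 - (z.1 : ℝ)) with hH
  have hs0 := z.1.2.1
  have hs1 := z.1.2.2
  have hHb : |H| ≤ 2 * ‖φ.toFun‖ + |k| + 1 := by
    have e1 : |φ.toFun z| ≤ ‖φ.toFun‖ := φ.toFun.norm_coe_le_norm z
    have e2 : |(1 - η) * (φ.toFun z - ‖φ.toFun‖)| ≤ 2 * ‖φ.toFun‖ := by
      rw [abs_mul, abs_of_nonneg (by linarith : 0 ≤ 1 - η)]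
      have e3 : |φ.toFun z - ‖φ.toFun‖| ≤ 2 * ‖φ.toFun‖ := by
        have := abs_le.1 e1
        exact abs_le.2 ⟨by linarith, by linarith⟩
      exact (mul_le_of_le_one_left (abs_nonneg _) (by linarith)).trans e3
    have e4 : |((1 - η) * k + η) * (1 - (z.1 : ℝ))| ≤ |k| + 1 := by
      rw [abs_mul, abs_of_nonneg (by linarith : 0 ≤ 1 - (z.1 : ℝ))]
      refine (mul_le_of_le_one_right (abs_nonneg _) (by linarith)).trans ?_
      refine (abs_add_le _ _).trans (add_le_add ?_ ?_)
      · rw [abs_mul, abs_of_nonneg (by linarith : 0 ≤ 1 - η)]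
        exact mul_le_of_le_one_left (abs_nonneg _) (by linarith)
      · rwa [abs_of_pos hη]
    have e5 : H = (1 - η) * (φ.toFun z - ‖φ.toFun‖) + ((1 - η) * k + η) * (1 - (z.1 : ℝ)) := by
      rw [hH]; ring
    rw [e5]
    exact (abs_add_le _ _).trans (by linarith)
  set H0 := 2 * ‖φ.toFun‖ + |k| + 1
  set X0 := ‖φ.dx.toBCF‖
  have hX0 : 0 ≤ X0 := norm_nonneg _
  have hH0 : 0 ≤ H0 := (abs_nonneg _).trans hHb
  have hx : |φ.dx z| ≤ X0 := φ.dx.toBCF.norm_coe_le_norm z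
  set θ := invQuad κ z.2
  have hθ0 : 0 < θ := invQuad_pos κ z.2
  have hθ1 : θ ≤ 1 := invQuad_le_one κ z.2
  have hd1 : |(bump κ hκ).d1 z.2| ≤ κ * θ := abs_invQuad_d1_le hκ z.2
  have hd2 : |(bump κ hκ).d2 z.2| ≤ 6 * κ ^ 2 * θ := abs_invQuad_d2_le κ z.2
  have hv0 := v.coe_nonneg
  have t1 : (bump κ hκ).toFun z.2 * ((1 - η) * φ.generator z p - ((1 - η) * k + η))
      ≤ θ * ((1 - η) * v - η) := by
    change θ * _ ≤ _
    refine mul_le_mul_of_nonneg_left ?_ hθ0.le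
    have := mul_le_mul_of_nonneg_left (hφ z p v hv) (by linarith : 0 ≤ 1 - η)
    linarith
  have t2 : (bump κ hκ).d1 z.2 * (H * p.1 + (1 - η) * φ.dx z * p.2)
      ≤ κ * θ * (H0 * |p.1| + X0 * |p.2|) := by
    refine (le_abs_self _).trans ?_
    rw [abs_mul]
    refine mul_le_mul hd1 ((abs_add_le _ _).trans (add_le_add ?_ ?_)) (abs_nonneg _) (by positivity)
    · rw [abs_mul]; gcongr
    · rw [abs_mul, abs_mul, abs_of_nonneg (by linarith : 0 ≤ 1 - η)]
      gcongr
      exact (mul_le_of_le_one_left (abs_nonneg _) (by linarith)).trans hx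
  have t3 : 1 / 2 * (bump κ hκ).d2 z.2 * H * p.2 ≤ κ * θ * (3 * H0 * |p.2|) := by
    refine (le_abs_self _).trans ?_
    rw [abs_mul, abs_mul, abs_mul, abs_of_pos (by norm_num : (0 : ℝ) < 1 / 2)]
    calc 1 / 2 * |(bump κ hκ).d2 z.2| * |H| * |p.2|
        ≤ 1 / 2 * (6 * κ ^ 2 * θ) * H0 * |p.2| := by gcongr
      _ = κ * (κ * θ * (3 * H0 * |p.2|)) := by ring
      _ ≤ _ := mul_le_of_le_one_left (by positivity) hκ1
  have t4 : H0 * |p.1| + X0 * |p.2| + 3 * H0 * |p.2| ≤ M * (2 * K * (1 + v)) := by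
    have e1 : |p.1| + |p.2| ≤ 2 * K * (1 + v) := by
      have := hw.abs_le p
      have := hw.le_cost z p v hv
      linarith
    have e2 : H0 * |p.1| + X0 * |p.2| + 3 * H0 * |p.2| ≤ M * (|p.1| + |p.2|) := by
      have := mul_nonneg hH0 (abs_nonneg p.1)
      have := mul_nonneg hX0 (abs_nonneg p.1)
      rw [hM]; linarith
    refine e2.trans (mul_le_mul_of_nonneg_left e1 ?_)
    rw [hM]; positivity
  have t5 : κ * θ * (H0 * |p.1| + X0 * |p.2|) + κ * θ * (3 * H0 * |p.2|) ≤ θ * (η * (1 + v)) := by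
    have e1 := mul_le_mul_of_nonneg_left t4 (by positivity : 0 ≤ κ * θ)
    have e2 := mul_le_mul_of_nonneg_left hκη (by positivity : 0 ≤ θ * (1 + v))
    linarith
  -- The margin `η` pays for the cutoff errors: `θ ((1 - η) v - η) + θ η (1 + v) = θ v ≤ v`.
  have t6 : θ * v ≤ v := mul_le_of_le_one_left hv0 hθ1
  linarith

/-- The dual bound extends to functions `φ + k (1 - t)`. -/
theorem dual_bound_of_generator_sub_le (hw : IsCostWeight F w K)
    (hD : dualValue ν F c ρ₀ ≤ (D : EReal)) {φ : TestFun} {k t : ℝ}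
    (hφ : ∀ z p (v : ℝ≥0), F z p = v → φ.generator z p - k ≤ v)
    (ht : ∀ μ : P2, -(∫ x, φ.slice 1 x ∂μ.meas) - c μ ≤ t) :
    -t - ∫ x, φ.slice 0 x ∂ρ₀.meas - k ≤ D := by
  set N := ‖φ.toFun‖
  set M := 3 * (2 * N + |k| + 1) + ‖φ.dx.toBCF‖ with hM
  have hM0 : 0 ≤ M := by positivity
  have hMK : 0 ≤ M * (2 * K) := by have := hw.pos; positivity
  let η : ℕ → ℝ := fun n => 1 / ((n : ℝ) + 1)
  -- Chosen so that `κ M (2 K) ≤ η` and `κ ≤ 1`; the `+ 1` also keeps the denominator positive.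
  let κ : ℕ → ℝ := fun n => η n / (M * (2 * K) + 1)
  have hη : ∀ n, 0 < η n := fun n => Nat.one_div_pos_of_nat
  have hη1 : ∀ n, η n ≤ 1 := fun n => by
    rw [div_le_one (by positivity)]
    have : (0 : ℝ) ≤ n := n.cast_nonneg
    linarith
  have hκ : ∀ n, 0 < κ n := fun n => div_pos (hη n) (by linarith)
  have hκ1 : ∀ n, κ n ≤ 1 := fun n => by
    rw [div_le_one (by linarith)]; linarith [hη1 n]
  have hκη : ∀ n, κ n * M * (2 * K) ≤ η n := fun n => by
    have e : κ n * (M * (2 * K) + 1) = η n := div_mul_cancel₀ _ (by linarith)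
    linarith [hκ n]
  have hηlim : Tendsto η atTop (𝓝 0) := tendsto_one_div_add_atTop_nhds_zero_nat
  have hκlim : Tendsto κ atTop (𝓝 0) := by simpa using hηlim.div_const (M * (2 * K) + 1)
  let G : ℕ → ℝ → ℝ := fun n x =>
    invQuad (κ n) x * ((1 - η n) * φ.slice 0 x + (1 - η n) * -N + ((1 - η n) * k + η n))
  have hbound : ∀ n, -(t + N) - ∫ x, G n x ∂ρ₀.meas ≤ D := by
    intro n
    have hsub := isHJBSubsolution_localize (ν := ν) hw hφ (hη n) (hη1 n) (hκ n) (hκ1 n) hM (hκη n)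
    refine (dual_bound hD hsub (t := t + N) fun μ => ?_).trans' (le_of_eq ?_)
    -- Subtracting `N = ‖φ‖` makes `φ₁ - N` nonpositive, so multiplying by a factor in `[0, 1]` only
    -- raises it and the terminal constraint survives. The shift cancels against the initial term in
    -- the limit.
    · have hle : ∫ x, (φ.slice 1 x - N) ∂μ.meas ≤ ∫ x, (φ.localize (bump (κ n) (hκ n)) (1 - η n)
          ((1 - η n) * -N) ((1 - η n) * k + η n)).slice 1 x ∂μ.meas := by
        refine integral_mono (((φ.slice 1).integrable _).sub (integrable_const _))
          (BoundedContinuousFunction.integrable _ _) fun x => ?_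
        change φ.toFun (1, x) - N ≤ invQuad (κ n) x * ((1 - η n) * φ.toFun (1, x)
          + (1 - η n) * -N + ((1 - η n) * k + η n) * (1 - ((1 : unitInterval) : ℝ)))
        have e1 : φ.toFun (1, x) ≤ N := (le_abs_self _).trans (φ.toFun.norm_coe_le_norm _)
        have e2 := invQuad_pos (κ n) x
        have e3 := invQuad_le_one (κ n) x
        have e4 : invQuad (κ n) x * (1 - η n) ≤ 1 :=
          mul_le_one₀ e3 (by linarith [hη1 n]) (by linarith [hη n])
        rw [Set.Icc.coe_one]
        nlinarith
      rw [integral_sub ((φ.slice 1).integrable _) (integrable_const _)] at hle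
      simp only [integral_const, probReal_univ, one_smul] at hle
      linarith [ht μ]
    · congr 1
      refine integral_congr_ae (ae_of_all _ fun x => ?_)
      change _ = invQuad (κ n) x * ((1 - η n) * φ.toFun (0, x)
          + (1 - η n) * -N + ((1 - η n) * k + η n) * (1 - ((0 : unitInterval) : ℝ)))
      rw [Set.Icc.coe_zero, sub_zero, mul_one]
      rfl
  have hlim : Tendsto (fun n => ∫ x, G n x ∂ρ₀.meas) atTop
      (𝓝 (∫ x, (φ.slice 0 x + -N + k) ∂ρ₀.meas)) := by
    refine tendsto_integral_of_dominated_convergence (fun _ => 2 * N + |k| + 1) (fun n => ?_)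
      (integrable_const _) (fun n => ae_of_all _ fun x => ?_) (ae_of_all _ fun x => ?_)
    · have := continuous_invQuad (κ n)
      exact (by fun_prop : Continuous (G n)).aestronglyMeasurable
    · have e1 : |φ.slice 0 x| ≤ N := φ.toFun.norm_coe_le_norm _
      have e2 := hη n
      have e3 := hη1 n
      have e4 : |(1 - η n) * φ.slice 0 x + (1 - η n) * -N + ((1 - η n) * k + η n)|
          ≤ 2 * N + |k| + 1 := by
        obtain ⟨h1, h2⟩ := abs_le.1 e1
        have h3 := neg_abs_le k
        have h4 := le_abs_self k
        have h5 := abs_nonneg k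
        rw [abs_le]; constructor <;> nlinarith
      rw [Real.norm_eq_abs, abs_mul, abs_of_pos (invQuad_pos _ _)]
      exact (mul_le_of_le_one_left (abs_nonneg _) (invQuad_le_one _ _)).trans e4
    · have h1 : Tendsto (fun n => 1 - η n) atTop (𝓝 1) := by simpa using hηlim.const_sub 1
      have := (tendsto_invQuad_one x hκlim).mul (((h1.mul_const (φ.slice 0 x)).add
        (h1.mul_const (-N))).add ((h1.mul_const k).add hηlim))
      simpa [G] using this
  have hfin := le_of_tendsto (hlim.const_sub (-(t + N))) (Eventually.of_forall hbound)
  have e : ∫ x, (φ.slice 0 x + -N + k) ∂ρ₀.meas = ∫ x, φ.slice 0 x ∂ρ₀.meas + -N + k := by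
    have i0 := (φ.slice 0).integrable ρ₀.meas
    simp_rw [add_assoc]
    rw [integral_add i0 (integrable_const _)]
    simp
  rw [e] at hfin
  linarith

end Multipliers

/-! ### Perturbed dual problems and Hahn–Banach separation -/

section Separation

variable {d : ℕ} {ν : TimeSpace → EuclideanSpace ℝ (Fin d)} {F : TimeSpace → ℝ × ℝ → ℝ≥0∞}
  {w : ℝ × ℝ → ℝ} {K : ℝ} {c : P2 → ℝ≥0} {ρ₀ : P2} {D : ℝ}

/-- The triples `(g, r, s)` for which the dual problem perturbed by `g` in the
Hamilton–Jacobi–Bellman inequality and by `r` in the terminal value has a value at most `s`. -/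
def perturbationSet (F : TimeSpace → ℝ × ℝ → ℝ≥0∞) (w : ℝ × ℝ → ℝ) (c : P2 → ℝ≥0) (ρ₀ : P2) :
    Set ((TimeSpace × (ℝ × ℝ) →ᵇ ℝ) × (ℝ →ᵇ ℝ) × ℝ) :=
  {y | ∃ (φ : TestFun) (k t : ℝ),
    (∀ z p (v : ℝ≥0), F z p = v → φ.generator z p - k + w p * y.1 (z, p) ≤ v) ∧
    (∀ μ : P2, -(∫ x, (φ.slice 1 + y.2.1) x ∂μ.meas) - c μ ≤ t) ∧
    t + ∫ x, φ.slice 0 x ∂ρ₀.meas + k ≤ y.2.2}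

theorem integral_linComb {X : Type*} [TopologicalSpace X] [MeasurableSpace X]
    [OpensMeasurableSpace X] (μ : Measure X) [IsFiniteMeasure μ] (a b : ℝ) (f g : X →ᵇ ℝ) :
    ∫ x, (a • f + b • g) x ∂μ = a * ∫ x, f x ∂μ + b * ∫ x, g x ∂μ := by
  simp only [BoundedContinuousFunction.coe_add, BoundedContinuousFunction.coe_smul, Pi.add_apply,
    smul_eq_mul]
  rw [integral_add ((f.integrable μ).const_mul a) ((g.integrable μ).const_mul b),
    integral_const_mul, integral_const_mul]

theorem convex_perturbationSet : Convex ℝ (perturbationSet F w c ρ₀) := by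
  rintro y ⟨φ, k, t, h1, h2, h3⟩ y' ⟨φ', k', t', h1', h2', h3'⟩ a b ha hb hab
  refine ⟨TestFun.linComb a b φ φ', a * k + b * k', a * t + b * t', fun z p v hv => ?_,
    fun μ => ?_, ?_⟩
  · rw [TestFun.linComb_generator]
    change _ + w p * (a * y.1 (z, p) + b * y'.1 (z, p)) ≤ _
    have e1 := mul_le_mul_of_nonneg_left (h1 z p v hv) ha
    have e2 := mul_le_mul_of_nonneg_left (h1' z p v hv) hb
    have e3 : (v : ℝ) = a * v + b * v := by rw [← add_mul, hab, one_mul]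
    rw [e3]
    linarith
  · have e : (TestFun.linComb a b φ φ').slice 1 + (a • y + b • y').2.1
        = a • (φ.slice 1 + y.2.1) + b • (φ'.slice 1 + y'.2.1) := by
      rw [TestFun.linComb_slice]
      simp only [Prod.snd_add, Prod.fst_add, Prod.smul_snd, Prod.smul_fst, smul_add]
      abel
    rw [e, integral_linComb]
    have e1 := mul_le_mul_of_nonneg_left (h2 μ) ha
    have e2 := mul_le_mul_of_nonneg_left (h2' μ) hb
    have e3 : (c μ : ℝ) = a * c μ + b * c μ := by rw [← add_mul, hab, one_mul]
    rw [e3]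
    linarith
  · rw [TestFun.linComb_slice, integral_linComb]
    change _ ≤ a * y.2.2 + b * y'.2.2
    have e1 := mul_le_mul_of_nonneg_left h3 ha
    have e2 := mul_le_mul_of_nonneg_left h3' hb
    linarith

/-- With `φ = 0`, the slack `k = 1` absorbs `w g ≤ w / K ≤ 1 + F` and `t = 1` absorbs `‖r‖ < 1`.
Every level above `k + t = 2` is reached, so `3` leaves room. -/
theorem mem_interior_perturbationSet (hw : IsCostWeight F w K) :
    ((0 : TimeSpace × (ℝ × ℝ) →ᵇ ℝ), (0 : ℝ →ᵇ ℝ), (3 : ℝ))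
      ∈ interior (perturbationSet F w c ρ₀) := by
  have hK := hw.pos
  rw [mem_interior]
  refine ⟨Metric.ball 0 K⁻¹ ×ˢ (Metric.ball 0 1 ×ˢ Set.Ioi 2), ?_,
    Metric.isOpen_ball.prod (Metric.isOpen_ball.prod isOpen_Ioi),
    Metric.mem_ball_self (inv_pos.2 hK), Metric.mem_ball_self one_pos, by norm_num⟩
  rintro ⟨g, r, s⟩ ⟨hg, hr, hs⟩
  rw [mem_ball_zero_iff] at hg hr
  refine ⟨0, 1, 1, fun z p v hv => ?_, fun μ => ?_, ?_⟩
  · rw [TestFun.zero_generator]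
    have e1 : g (z, p) ≤ K⁻¹ := (le_abs_self _).trans ((g.norm_coe_le_norm _).trans hg.le)
    have e2 := mul_le_mul_of_nonneg_left e1 (hw.pos' p).le
    have e3 := mul_le_mul_of_nonneg_right (hw.le_cost z p v hv) (inv_pos.2 hK).le
    have e4 : K * (1 + v) * K⁻¹ = 1 + v := by field_simp
    change 0 - 1 + w p * g (z, p) ≤ v
    linarith
  · rw [TestFun.zero_slice, zero_add]
    have e1 : |∫ x, r x ∂μ.meas| ≤ ‖r‖ := by
      simpa using r.norm_integral_le_norm μ.meas
    have e2 := (abs_le.1 e1).1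
    have e3 := (c μ).coe_nonneg
    have e4 : ‖r‖ < 1 := hr
    change -(∫ x, r x ∂μ.meas) - c μ ≤ 1
    linarith
  · rw [TestFun.zero_slice]
    have : (2 : ℝ) < s := hs
    simp only [BoundedContinuousFunction.coe_zero, Pi.zero_apply, integral_zero]
    linarith

/-- The zero function is admissible since the cost is nonnegative, and its conjugate term is at most
zero since the penalty is. -/
theorem nonneg_of_dualValue_le (hw : IsCostWeight F w K)
    (hD : dualValue ν F c ρ₀ ≤ (D : EReal)) : 0 ≤ D := by
  have := dual_bound_of_generator_sub_le (φ := 0) (k := 0) (t := 0) hw hD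
    (fun z p v _ => by rw [TestFun.zero_generator, sub_zero]; exact v.coe_nonneg)
    (fun μ => by rw [TestFun.zero_slice]; simp)
  rw [TestFun.zero_slice] at this
  simpa using this

/-- Lagrange multipliers of the dual problem. -/
theorem exists_multipliers (hw : IsCostWeight F w K) (hD : dualValue ν F c ρ₀ ≤ (D : EReal)) :
    ∃ (ℓ : (TimeSpace × (ℝ × ℝ) →ᵇ ℝ) →L[ℝ] ℝ) (L : (ℝ →ᵇ ℝ) →L[ℝ] ℝ),
      ∀ y ∈ perturbationSet F w c ρ₀, ℓ y.1 - L y.2.1 ≤ D + y.2.2 := by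
  have hD0 : 0 ≤ D := nonneg_of_dualValue_le hw hD
  have hlow : ∀ s, ((0 : TimeSpace × (ℝ × ℝ) →ᵇ ℝ), (0 : ℝ →ᵇ ℝ), s) ∈ perturbationSet F w c ρ₀ →
      -D ≤ s := by
    rintro s ⟨φ, k, t, h1, h2, h3⟩
    have := dual_bound_of_generator_sub_le hw hD (φ := φ) (k := k) (t := t)
      (fun z p v hv => by simpa using h1 z p v hv) (fun μ => by simpa using h2 μ)
    change _ ≤ s at h3
    linarith
  set S := perturbationSet F w c ρ₀
  have hconv : Convex ℝ S := convex_perturbationSet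
  have hint := mem_interior_perturbationSet (c := c) (ρ₀ := ρ₀) hw
  have hnot : ((0 : TimeSpace × (ℝ × ℝ) →ᵇ ℝ), (0 : ℝ →ᵇ ℝ), -D) ∉ interior S := by
    intro hmem
    have hcont : Continuous fun s : ℝ => ((0 : TimeSpace × (ℝ × ℝ) →ᵇ ℝ), (0 : ℝ →ᵇ ℝ), s) := by
      fun_prop
    have hev : ∀ᶠ s in 𝓝 (-D), ((0 : TimeSpace × (ℝ × ℝ) →ᵇ ℝ), (0 : ℝ →ᵇ ℝ), s) ∈ interior S :=
      hcont.continuousAt (isOpen_interior.mem_nhds hmem)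
    have hev' : ∀ᶠ s in 𝓝 (-D), -D ≤ s := hev.mono fun s hs => hlow s (interior_subset hs)
    obtain ⟨s, hs, hs'⟩ := ((hev'.filter_mono nhdsWithin_le_nhds).and
      (self_mem_nhdsWithin : Set.Iio (-D) ∈ 𝓝[<] (-D))).exists
    exact absurd hs (not_le.2 hs')
  obtain ⟨f, hf⟩ := geometric_hahn_banach_open_point hconv.interior isOpen_interior hnot
  have hfS : ∀ y ∈ S, f y ≤ f (0, 0, -D) := by
    intro y hy
    have hcl : y ∈ closure (interior S) := by
      rw [hconv.closure_interior_eq_closure_of_nonempty_interior ⟨_, hint⟩]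
      exact subset_closure hy
    exact closure_minimal (fun a ha => (hf a ha).le)
      (isClosed_le f.continuous continuous_const) hcl
  set m := f (0, 0, 1) with hm
  have hs : ∀ s : ℝ, f (0, 0, s) = s * m := by
    intro s
    have : ((0 : TimeSpace × (ℝ × ℝ) →ᵇ ℝ), (0 : ℝ →ᵇ ℝ), s) = s • (0, 0, 1) := by simp
    rw [this, map_smul, smul_eq_mul]
  -- Strict separation of the interior point at height `3` from height `-D ≤ 0` gives `(3 + D) m <
  -- 0`, so one may normalize by `-m`.
  have hmneg : m < 0 := by
    have := hf _ hint
    rw [hs, hs] at this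
    nlinarith
  let ℓ : (TimeSpace × (ℝ × ℝ) →ᵇ ℝ) →L[ℝ] ℝ :=
    (-m)⁻¹ • f.comp (ContinuousLinearMap.inl ℝ _ _)
  let L : (ℝ →ᵇ ℝ) →L[ℝ] ℝ :=
    m⁻¹ • f.comp ((ContinuousLinearMap.inr ℝ _ _).comp (ContinuousLinearMap.inl ℝ _ _))
  refine ⟨ℓ, L, fun y hy => ?_⟩
  have e : f y = f (y.1, 0, 0) + f (0, y.2.1, 0) + y.2.2 * m := by
    rw [← hs, ← map_add, ← map_add]; simp
  have h1 := hfS y hy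
  rw [e, hs] at h1
  change (-m)⁻¹ * f (y.1, 0, 0) - m⁻¹ * f (0, y.2.1, 0) ≤ _
  have h2 : (-m)⁻¹ * f (y.1, 0, 0) - m⁻¹ * f (0, y.2.1, 0)
      = (f (y.1, 0, 0) + f (0, y.2.1, 0)) / (-m) := by
    rw [inv_neg, div_neg, div_eq_mul_inv]; ring
  rw [h2, div_le_iff₀ (by linarith)]
  linarith

end Separation

/-! ### From multipliers to a measure on controls -/

section YoungMeasure

variable {d : ℕ} {ν : TimeSpace → EuclideanSpace ℝ (Fin d)} {F : TimeSpace → ℝ × ℝ → ℝ≥0∞}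
  {w : ℝ × ℝ → ℝ} {K : ℝ} {c : P2 → ℝ≥0} {ρ₀ : P2} {D : ℝ}

theorem TestFun.continuous_generator (φ : TestFun) :
    Continuous fun q : TimeSpace × (ℝ × ℝ) => φ.generator q.1 q.2 := by
  unfold TestFun.generator
  fun_prop

theorem TestFun.abs_generator_le (φ : TestFun) (z : TimeSpace) (p : ℝ × ℝ) :
    |φ.generator z p| ≤ (|φ.dt z| + |φ.dx z| + |φ.dxx z|) * (1 + |p.1| + |p.2|) := by
  have h1 : |φ.generator z p| ≤ |φ.dt z| + |φ.dx z| * |p.1| + 1 / 2 * |φ.dxx z| * |p.2| := by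
    rw [TestFun.generator]
    refine (abs_add_le _ _).trans (add_le_add ((abs_add_le _ _).trans ?_) ?_)
    · rw [abs_mul]
    · rw [abs_mul, abs_mul, abs_of_pos (by norm_num : (0 : ℝ) < 1 / 2)]
  refine h1.trans ?_
  have a1 := abs_nonneg (φ.dt z)
  have a2 := abs_nonneg (φ.dx z)
  have a3 := abs_nonneg (φ.dxx z)
  have a4 := abs_nonneg p.1
  have a5 := abs_nonneg p.2
  nlinarith [mul_nonneg a1 a4, mul_nonneg a1 a5, mul_nonneg a2 a5, mul_nonneg a3 a4,
    mul_nonneg a3 a5]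

/-- The generator divided by the weight vanishes at infinity. -/
def TestFun.weightedGenerator (φ : TestFun) (hw : IsCostWeight F w K) :
    C₀(TimeSpace × (ℝ × ℝ), ℝ) where
  toFun q := φ.generator q.1 q.2 / w q.2
  continuous_toFun := φ.continuous_generator.div (hw.continuous.comp continuous_snd)
    fun q => (hw.pos' q.2).ne'
  zero_at_infty' := by
    let α : TimeSpace → ℝ := fun z => |φ.dt z| + |φ.dx z| + |φ.dxx z|
    let β : ℝ × ℝ → ℝ := fun p => (1 + |p.1| + |p.2|) / w p
    have hα : Tendsto α (cocompact TimeSpace) (𝓝 0) := by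
      have h1 := φ.dt.zero_at_infty'.abs
      have h2 := φ.dx.zero_at_infty'.abs
      have h3 := φ.dxx.zero_at_infty'.abs
      simpa using (h1.add h2).add h3
    have hβ3 : ∀ p, |β p| ≤ 3 := fun p => by
      have h1 := hw.abs_le p
      have h2 := hw.one_le p
      have h3 := hw.pos' p
      rw [abs_of_nonneg (by positivity), div_le_iff₀ h3]
      linarith
    have hαb : ∀ z, |α z| ≤ ‖φ.dt.toBCF‖ + ‖φ.dx.toBCF‖ + ‖φ.dxx.toBCF‖ := fun z => by
      rw [abs_of_nonneg (by positivity)]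
      exact add_le_add (add_le_add (φ.dt.toBCF.norm_coe_le_norm z)
        (φ.dx.toBCF.norm_coe_le_norm z)) (φ.dxx.toBCF.norm_coe_le_norm z)
    have hle : ∀ q : TimeSpace × (ℝ × ℝ), ‖φ.generator q.1 q.2 / w q.2‖ ≤ α q.1 * β q.2 := by
      intro q
      rw [Real.norm_eq_abs, abs_div, abs_of_pos (hw.pos' q.2), ← mul_div_assoc]
      have := hw.pos' q.2
      gcongr
      exact φ.abs_generator_le q.1 q.2
    refine squeeze_zero_norm hle ?_
    -- A point of the product escapes through time-space, where `α → 0` and `β ≤ 3`, or through the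
    -- controls, where `β → 0` and `α` is bounded.
    rw [← coprod_cocompact, Filter.coprod, tendsto_sup]
    constructor
    · exact (hα.comp tendsto_comap).zero_mul_isBoundedUnder_le
        (isBoundedUnder_of ⟨3, fun q => hβ3 q.2⟩)
    · exact isBoundedUnder_le_mul_tendsto_zero
        (isBoundedUnder_of ⟨_, fun q => hαb q.1⟩) (hw.tendsto.comp tendsto_comap)

/-- The defining property of Lagrange multipliers. -/
def IsMultiplier (F : TimeSpace → ℝ × ℝ → ℝ≥0∞) (w : ℝ × ℝ → ℝ) (c : P2 → ℝ≥0) (ρ₀ : P2) (D : ℝ)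
    (ℓ : (TimeSpace × (ℝ × ℝ) →ᵇ ℝ) →L[ℝ] ℝ) (L : (ℝ →ᵇ ℝ) →L[ℝ] ℝ) : Prop :=
  ∀ y ∈ perturbationSet F w c ρ₀, ℓ y.1 - L y.2.1 ≤ D + y.2.2

variable {ℓ : (TimeSpace × (ℝ × ℝ) →ᵇ ℝ) →L[ℝ] ℝ} {L : (ℝ →ᵇ ℝ) →L[ℝ] ℝ}

theorem IsMultiplier.le (h : IsMultiplier F w c ρ₀ D ℓ L) {g : TimeSpace × (ℝ × ℝ) →ᵇ ℝ}
    {r : ℝ →ᵇ ℝ} {t : ℝ} (hg : ∀ z p (v : ℝ≥0), F z p = v → w p * g (z, p) ≤ v)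
    (hr : ∀ μ : P2, -(∫ x, r x ∂μ.meas) - c μ ≤ t) : ℓ g - L r ≤ D + t := by
  refine h (g, r, t) ⟨0, 0, t, fun z p v hv => ?_, fun μ => ?_, ?_⟩
  · rw [TestFun.zero_generator, sub_zero, zero_add]; exact hg z p v hv
  · rw [TestFun.zero_slice, zero_add]; exact hr μ
  · rw [TestFun.zero_slice]; simp

theorem nonneg_of_forall_nat_mul_le {a M : ℝ} (h : ∀ n : ℕ, -(n * a) ≤ M) : 0 ≤ a := by
  by_contra! ha
  obtain ⟨n, hn⟩ := exists_nat_gt (M / -a)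
  rw [div_lt_iff₀ (by linarith)] at hn
  linarith [h n]

/-- Pushing `g` down by any multiple keeps the constraint satisfied, so the multiplier inequality
holds for all `-n g` with the fixed bound `D`. -/
theorem IsMultiplier.nonneg (hw : IsCostWeight F w K) (h : IsMultiplier F w c ρ₀ D ℓ L)
    {g : TimeSpace × (ℝ × ℝ) →ᵇ ℝ} (hg : ∀ q, 0 ≤ g q) : 0 ≤ ℓ g := by
  refine nonneg_of_forall_nat_mul_le (M := D) fun n => ?_
  have := h.le (g := -((n : ℝ) • g)) (r := 0) (t := 0) (fun z p v _ => ?_) (fun μ => by simp)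
  · simpa using this
  · change w p * -((n : ℝ) * g (z, p)) ≤ v
    have h1 := mul_nonneg (hw.pos' p).le (mul_nonneg n.cast_nonneg (hg (z, p)))
    have h2 := v.coe_nonneg
    linarith

theorem IsMultiplier.terminal_nonneg (h : IsMultiplier F w c ρ₀ D ℓ L)
    {r : ℝ →ᵇ ℝ} (hr : ∀ x, 0 ≤ r x) : 0 ≤ L r := by
  refine nonneg_of_forall_nat_mul_le (M := D) fun n => ?_
  have := h.le (g := 0) (r := (n : ℝ) • r) (t := 0) (fun z p v _ => by simp) (fun μ => ?_)
  · simpa using this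
  · have h1 : 0 ≤ ∫ x, ((n : ℝ) • r) x ∂μ.meas :=
      integral_nonneg fun x => mul_nonneg n.cast_nonneg (hr x)
    have h2 := (c μ).coe_nonneg
    linarith

/-- A constant `s` can be moved from `r` to `t`, with either sign, because all laws have mass one;
linearity in `s` forces equality. -/
theorem IsMultiplier.terminal_one (h : IsMultiplier F w c ρ₀ D ℓ L) : L 1 = 1 := by
  have key : ∀ s : ℝ, -(s * (L 1 - 1)) ≤ D := fun s => by
    have := h.le (g := 0) (r := s • 1) (t := -s) (fun z p v _ => by simp) (fun μ => by simp)
    rw [map_zero, map_smul, smul_eq_mul] at this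
    linarith
  have h1 : 0 ≤ L 1 - 1 := nonneg_of_forall_nat_mul_le fun n => key n
  have h2 : 0 ≤ -(L 1 - 1) := nonneg_of_forall_nat_mul_le (M := D) fun n => by
    linarith [key (-n)]
  linarith

/-- The test function `-s φ` exactly cancels the perturbation `s (generator / w, φ₁)`. The
multiplier inequality is then linear in `s` and bounded by `D` for both signs, so the defect `E`
vanishes. -/
theorem IsMultiplier.fokkerPlanck (hw : IsCostWeight F w K) (h : IsMultiplier F w c ρ₀ D ℓ L)
    (φ : TestFun) :
    L (φ.slice 1) - ∫ x, φ.slice 0 x ∂ρ₀.meas = ℓ (φ.weightedGenerator hw).toBCF := by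
  set E := L (φ.slice 1) - ∫ x, φ.slice 0 x ∂ρ₀.meas - ℓ (φ.weightedGenerator hw).toBCF with hE
  have key : ∀ s : ℝ, -(s * E) ≤ D := fun s => by
    have := h (s • (φ.weightedGenerator hw).toBCF, s • φ.slice 1,
      -(s * ∫ x, φ.slice 0 x ∂ρ₀.meas)) ⟨TestFun.linComb (-s) 0 φ 0, 0, 0, fun z p v _ => ?_,
        fun μ => ?_, ?_⟩
    · simp only [map_smul, smul_eq_mul] at this
      rw [hE]; linarith
    · rw [TestFun.linComb_generator]
      change _ + w p * (s * (φ.generator z p / w p)) ≤ _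
      have e : w p * (s * (φ.generator z p / w p)) = s * φ.generator z p := by
        have := (hw.pos' p).ne'
        field_simp
      rw [e]
      have := v.coe_nonneg
      linarith
    · rw [TestFun.linComb_slice]
      simp
    · rw [TestFun.linComb_slice, integral_linComb]
      simp
  have h1 : 0 ≤ E := nonneg_of_forall_nat_mul_le fun n => key n
  have h2 : 0 ≤ -E := nonneg_of_forall_nat_mul_le (M := D) fun n => by linarith [key (-n)]
  linarith

/-- The terminal multiplier is tight. -/
theorem IsMultiplier.tendsto_bump (hw : IsCostWeight F w K) (h : IsMultiplier F w c ρ₀ D ℓ L)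
    {κ : ℕ → ℝ} (hκ : ∀ n, 0 < κ n) (hκ1 : ∀ n, κ n ≤ 1) (hlim : Tendsto κ atTop (𝓝 0)) :
    Tendsto (fun n => L (bump (κ n) (hκ n)).toFun.toBCF) atTop (𝓝 1) := by
  have hφ : ∀ n, L (bump (κ n) (hκ n)).toFun.toBCF = ∫ x, invQuad (κ n) x ∂ρ₀.meas
      + ℓ (((0 : TestFun).localize (bump (κ n) (hκ n)) 0 1 0).weightedGenerator hw).toBCF := by
    intro n
    have hslice : ∀ τ, ((0 : TestFun).localize (bump (κ n) (hκ n)) 0 1 0).slice τ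
        = (bump (κ n) (hκ n)).toFun.toBCF := fun τ => by
      ext x
      change (bump (κ n) (hκ n)).toFun x * (0 * 0 + 1 + 0 * (1 - (τ : ℝ))) = _
      simp
    have := h.fokkerPlanck hw ((0 : TestFun).localize (bump (κ n) (hκ n)) 0 1 0)
    rw [hslice, hslice] at this
    have e : ∫ x, (bump (κ n) (hκ n)).toFun.toBCF x ∂ρ₀.meas = ∫ x, invQuad (κ n) x ∂ρ₀.meas := rfl
    linarith
  simp_rw [hφ]
  have h1 : Tendsto (fun n => ∫ x, invQuad (κ n) x ∂ρ₀.meas) atTop (𝓝 1) := by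
    have : (1 : ℝ) = ∫ _, (1 : ℝ) ∂ρ₀.meas := by simp
    rw [this]
    refine tendsto_integral_of_dominated_convergence (fun _ => 1)
      (fun n => (continuous_invQuad _).aestronglyMeasurable) (integrable_const _)
      (fun n => ae_of_all _ fun x => ?_) (ae_of_all _ fun x => tendsto_invQuad_one x hlim)
    rw [Real.norm_eq_abs, abs_of_pos (invQuad_pos _ _)]
    exact invQuad_le_one _ _
  have h2 : Tendsto (fun n =>
      ℓ (((0 : TestFun).localize (bump (κ n) (hκ n)) 0 1 0).weightedGenerator hw).toBCF)
      atTop (𝓝 0) := by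
    -- With derivatives of the cutoff at most `κ` and `6 κ`, and `|p.1| + |p.2| ≤ 2 w`, the weighted
    -- generator of the time-independent cutoff is uniformly of order `κ`.
    have hb : ∀ n, ‖ℓ (((0 : TestFun).localize (bump (κ n) (hκ n)) 0 1 0).weightedGenerator
        hw).toBCF‖ ≤ ‖ℓ‖ * (6 * κ n) := by
      intro n
      refine (ℓ.le_opNorm _).trans (mul_le_mul_of_nonneg_left ?_ (norm_nonneg _))
      have hκn := hκ n
      refine (BoundedContinuousFunction.norm_le (by positivity)).2 fun q => ?_
      change ‖((0 : TestFun).localize (bump (κ n) (hκ n)) 0 1 0).generator q.1 q.2 / w q.2‖ ≤ _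
      rw [Real.norm_eq_abs, abs_div, abs_of_pos (hw.pos' q.2), div_le_iff₀ (hw.pos' q.2),
        TestFun.localize_generator]
      have e1 : (bump (κ n) (hκ n)).toFun q.1.2 * (0 * (0 : TestFun).generator q.1 q.2 - 0)
          + (bump (κ n) (hκ n)).d1 q.1.2 * ((0 * (0 : TestFun).toFun q.1 + 1
            + 0 * (1 - (q.1.1 : ℝ))) * q.2.1 + 0 * (0 : TestFun).dx q.1 * q.2.2)
          + 1 / 2 * (bump (κ n) (hκ n)).d2 q.1.2 * (0 * (0 : TestFun).toFun q.1 + 1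
            + 0 * (1 - (q.1.1 : ℝ))) * q.2.2
          = (bump (κ n) (hκ n)).d1 q.1.2 * q.2.1
            + 1 / 2 * (bump (κ n) (hκ n)).d2 q.1.2 * q.2.2 := by ring
      rw [e1]
      have d1 : |(bump (κ n) (hκ n)).d1 q.1.2| ≤ κ n :=
        (abs_invQuad_d1_le (hκ n) q.1.2).trans
          (mul_le_of_le_one_right (hκ n).le (invQuad_le_one _ _))
      have d2 : |(bump (κ n) (hκ n)).d2 q.1.2| ≤ 6 * κ n := by
        refine (abs_invQuad_d2_le (κ n) q.1.2).trans
          ((mul_le_of_le_one_right (by positivity) (invQuad_le_one _ _)).trans ?_)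
        nlinarith [hκ n, hκ1 n]
      have e2 := hw.abs_le q.2
      calc |(bump (κ n) (hκ n)).d1 q.1.2 * q.2.1 + 1 / 2 * (bump (κ n) (hκ n)).d2 q.1.2 * q.2.2|
          ≤ |(bump (κ n) (hκ n)).d1 q.1.2| * |q.2.1|
            + 1 / 2 * |(bump (κ n) (hκ n)).d2 q.1.2| * |q.2.2| := by
            refine (abs_add_le _ _).trans (le_of_eq ?_)
            rw [abs_mul, abs_mul, abs_mul, abs_of_pos (by norm_num : (0 : ℝ) < 1 / 2)]
        _ ≤ κ n * |q.2.1| + 1 / 2 * (6 * κ n) * |q.2.2| := by gcongr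
        _ ≤ 3 * κ n * (|q.2.1| + |q.2.2|) := by nlinarith [mul_nonneg hκn.le (abs_nonneg q.2.1)]
        _ ≤ 3 * κ n * (2 * w q.2) := by gcongr
        _ = _ := by ring
    refine squeeze_zero_norm hb ?_
    simpa using (hlim.const_mul 6).const_mul ‖ℓ‖
  simpa using h1.add h2

/-- The terminal multiplier is a probability measure. -/
theorem IsMultiplier.exists_terminal (hw : IsCostWeight F w K)
    (h : IsMultiplier F w c ρ₀ D ℓ L) :
    ∃ ρ₁ : ProbabilityMeasure ℝ, ∀ r : ℝ →ᵇ ℝ, L r = ∫ x, r x ∂(ρ₁ : Measure ℝ) := by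
  obtain ⟨μ, hμ, hLμ⟩ := exists_measure_of_positive L fun r hr => h.terminal_nonneg hr
  let κ : ℕ → ℝ := fun n => 1 / ((n : ℝ) + 1)
  have hκ : ∀ n, 0 < κ n := fun n => Nat.one_div_pos_of_nat
  have hκ1 : ∀ n, κ n ≤ 1 := fun n => by
    rw [div_le_one (by positivity)]
    have : (0 : ℝ) ≤ n := n.cast_nonneg
    linarith
  have hlim : Tendsto κ atTop (𝓝 0) := tendsto_one_div_add_atTop_nhds_zero_nat
  have htight := h.tendsto_bump hw hκ hκ1 hlim
  let θ : ℕ → ℝ →ᵇ ℝ := fun n => (bump (κ n) (hκ n)).toFun.toBCF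
  have hθ0 : ∀ n x, 0 < θ n x := fun n x => invQuad_pos _ _
  have hθ1 : ∀ n x, θ n x ≤ 1 := fun n x => invQuad_le_one _ _
  have hrep : ∀ r : ℝ →ᵇ ℝ, L r = ∫ x, r x ∂μ := by
    intro r
    have h1 : Tendsto (fun n => L (θ n * r)) atTop (𝓝 (∫ x, r x ∂μ)) := by
      have e : ∀ n, L (θ n * r) = ∫ x, θ n x * r x ∂μ := fun n => by
        refine hLμ (θ n * r) ?_
        have h0 : Tendsto (θ n) (cocompact ℝ) (𝓝 0) := (bump (κ n) (hκ n)).toFun.zero_at_infty'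
        exact h0.zero_mul_isBoundedUnder_le
          (isBoundedUnder_of ⟨‖r‖, fun z => r.norm_coe_le_norm z⟩)
      simp_rw [e]
      refine tendsto_integral_of_dominated_convergence (fun _ => ‖r‖)
        (fun n => ((θ n).continuous.mul r.continuous).aestronglyMeasurable) (integrable_const _)
        (fun n => ae_of_all _ fun x => ?_) (ae_of_all _ fun x => ?_)
      · rw [norm_mul, Real.norm_eq_abs, abs_of_pos (hθ0 n x)]
        exact (mul_le_of_le_one_left (norm_nonneg _) (hθ1 n x)).trans (r.norm_coe_le_norm x)
      · have hx : Tendsto (fun n => θ n x) atTop (𝓝 1) := tendsto_invQuad_one x hlim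
        simpa using hx.mul_const (r x)
    have h2 : Tendsto (fun n => L (θ n * r)) atTop (𝓝 (L r)) := by
      rw [tendsto_iff_norm_sub_tendsto_zero]
      -- Positivity transfers `|θ r - r| ≤ ‖r‖ (1 - θ)` to `L`, and tightness sends the right side
      -- to zero.
      have hb : ∀ n, ‖L (θ n * r) - L r‖ ≤ ‖r‖ * (1 - L (θ n)) := by
        intro n
        have e : ‖r‖ * (1 - L (θ n)) = L (‖r‖ • (1 - θ n)) := by
          rw [map_smul, map_sub, h.terminal_one, smul_eq_mul]
        have hle : ∀ x, |θ n x * r x - r x| ≤ ‖r‖ * (1 - θ n x) := fun x => by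
          rw [show θ n x * r x - r x = -((1 - θ n x) * r x) by ring, abs_neg, abs_mul,
            abs_of_nonneg (by linarith [hθ1 n x]), mul_comm]
          exact mul_le_mul_of_nonneg_right (r.norm_coe_le_norm x) (by linarith [hθ1 n x])
        rw [← map_sub, Real.norm_eq_abs, e, abs_le]
        constructor
        · have := h.terminal_nonneg (r := (θ n * r - r) + ‖r‖ • (1 - θ n)) fun x => by
            have := (abs_le.1 (hle x)).1
            change 0 ≤ θ n x * r x - r x + ‖r‖ * (1 - θ n x)
            linarith
          rw [map_add] at this
          linarith
        · have := h.terminal_nonneg (r := ‖r‖ • (1 - θ n) - (θ n * r - r)) fun x => by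
            have := (abs_le.1 (hle x)).2
            change 0 ≤ ‖r‖ * (1 - θ n x) - (θ n x * r x - r x)
            linarith
          rw [map_sub] at this
          linarith
      refine squeeze_zero (fun n => norm_nonneg _) hb ?_
      simpa using (htight.const_sub 1).const_mul ‖r‖
    exact tendsto_nhds_unique h2 h1
  have hprob : IsProbabilityMeasure μ := by
    have := hrep 1
    rw [h.terminal_one] at this
    simp only [BoundedContinuousFunction.coe_one, Pi.one_apply, integral_const, smul_eq_mul,
      mul_one] at this
    exact ⟨by rw [← ENNReal.toReal_eq_one_iff]; exact this.symm⟩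
  exact ⟨⟨μ, hprob⟩, hrep⟩

/-- The dual bound yields a measure on time, space and controls whose barycentre solves the
Fokker–Planck equation. -/
theorem exists_controlMeasure (hw : IsCostWeight F w K)
    (hF_lsc : LowerSemicontinuous fun q : TimeSpace × (ℝ × ℝ) => F q.1 q.2)
    (hD : dualValue ν F c ρ₀ ≤ (D : EReal)) :
    ∃ (π : Measure (TimeSpace × (ℝ × ℝ))) (ρ₁ : ProbabilityMeasure ℝ), IsFiniteMeasure π ∧
      Integrable (fun q => q.2.1) π ∧ Integrable (fun q => q.2.2) π ∧
      (∀ φ : TestFun, (∫ x, φ.slice 1 x ∂(ρ₁ : Measure ℝ)) - ∫ x, φ.slice 0 x ∂ρ₀.meas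
        = ∫ q, φ.generator q.1 q.2 ∂π) ∧
      ∀ (r : ℝ →ᵇ ℝ) (t : ℝ), (∀ μ : P2, -(∫ x, r x ∂μ.meas) - c μ ≤ t) →
        0 ≤ D + t + ∫ x, r x ∂(ρ₁ : Measure ℝ) ∧
        ∫⁻ q, F q.1 q.2 ∂π ≤ ENNReal.ofReal (D + t + ∫ x, r x ∂(ρ₁ : Measure ℝ)) := by
  obtain ⟨ℓ, L, hm⟩ := exists_multipliers hw hD
  have h : IsMultiplier F w c ρ₀ D ℓ L := hm
  obtain ⟨ρ₁, hρ₁⟩ := h.exists_terminal hw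
  obtain ⟨π', hπ', hℓ⟩ := exists_measure_of_positive ℓ fun g hg => h.nonneg hw hg
  let u : TimeSpace × (ℝ × ℝ) → ℝ≥0 := fun q => Real.toNNReal (w q.2)⁻¹
  have hwc : Continuous fun q : TimeSpace × (ℝ × ℝ) => (w q.2)⁻¹ :=
    (hw.continuous.comp continuous_snd).inv₀ fun q => (hw.pos' q.2).ne'
  have hu : Measurable u := hwc.measurable.real_toNNReal
  have hu' : ∀ q, (u q : ℝ) = (w q.2)⁻¹ := fun q =>
    Real.coe_toNNReal _ (inv_nonneg.2 (hw.pos' q.2).le)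
  -- Since `ℓ` tests functions divided by `w`, the density `1 / w` restores unweighted integrals and
  -- makes the controls integrable.
  let π : Measure (TimeSpace × (ℝ × ℝ)) := π'.withDensity fun q => u q
  have hint : ∀ g : TimeSpace × (ℝ × ℝ) → ℝ, ∫ q, g q ∂π = ∫ q, g q / w q.2 ∂π' := fun g => by
    rw [integral_withDensity_eq_integral_smul hu]
    refine integral_congr_ae (ae_of_all _ fun q => ?_)
    change (u q : ℝ) * g q = g q / w q.2
    rw [hu', div_eq_inv_mul]
  have hintb : ∀ (g : TimeSpace × (ℝ × ℝ) → ℝ) (C : ℝ), Continuous g →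
      (∀ q, |g q| ≤ C * w q.2) → Integrable g π := fun g C hg hC => by
    rw [integrable_withDensity_iff_integrable_smul hu]
    refine Integrable.of_bound (C := C) ?_ (ae_of_all _ fun q => ?_)
    · exact (hu.coe_nnreal_real.mul hg.measurable).aestronglyMeasurable
    · change |(u q : ℝ) * g q| ≤ C
      have := hw.pos' q.2
      rw [hu', abs_mul, abs_of_pos (inv_pos.2 this), inv_mul_le_iff₀ this, mul_comm]
      exact hC q
  have hπ : IsFiniteMeasure π := by
    refine isFiniteMeasure_withDensity ?_
    refine ne_top_of_le_ne_top (b := ∫⁻ _, 1 ∂π') (by simp) (lintegral_mono fun q => ?_)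
    have h1 : u q ≤ 1 := by
      rw [← NNReal.coe_le_coe, hu', NNReal.coe_one]
      exact inv_le_one_of_one_le₀ (hw.one_le q.2)
    exact ENNReal.coe_le_coe.2 h1
  refine ⟨π, ρ₁, hπ, ?_, ?_, fun φ => ?_, fun r t hr => ?_⟩
  · refine hintb _ 2 (by fun_prop) fun q => ?_
    linarith [hw.abs_le q.2, abs_nonneg q.2.2]
  · refine hintb _ 2 (by fun_prop) fun q => ?_
    linarith [hw.abs_le q.2, abs_nonneg q.2.1]
  · rw [← hρ₁, h.fokkerPlanck hw φ, hint]
    exact hℓ _ (φ.weightedGenerator hw).zero_at_infty'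
  · refine ⟨?_, ?_⟩
    · have := h.le (g := 0) (fun z p v _ => by simp) hr
      rw [map_zero, hρ₁] at this
      linarith
    refine lintegral_le_of_forall_compactSupport π hF_lsc _ fun g hgc hg0 hgF => ?_
    let gw : TimeSpace × (ℝ × ℝ) →ᵇ ℝ :=
      BoundedContinuousFunction.ofNormedAddCommGroup (fun q => g q / w q.2)
        (g.continuous.div (hw.continuous.comp continuous_snd) fun q => (hw.pos' q.2).ne') ‖g‖
        fun q => by
          rw [norm_div, Real.norm_of_nonneg (hw.pos' q.2).le]
          exact (div_le_self (norm_nonneg _) (hw.one_le q.2)).trans (g.norm_coe_le_norm q)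
    have hgw0 : Tendsto gw (cocompact _) (𝓝 0) := by
      have hc : HasCompactSupport gw := HasCompactSupport.intro hgc.isCompact fun q hq => by
        change g q / w q.2 = 0
        rw [image_eq_zero_of_notMem_tsupport hq, zero_div]
      exact hc.is_zero_at_infty
    have hle := h.le (g := gw) (r := r) (t := t) (fun z p v hv => ?_) hr
    · rw [hℓ gw hgw0, hρ₁] at hle
      rw [hint]
      change ∫ q, g q / w q.2 ∂π' - _ ≤ _ at hle
      linarith
    · change w p * (g (z, p) / w p) ≤ v
      rw [mul_div_cancel₀ _ (hw.pos' p).ne']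
      have h1 := hgF (z, p)
      rw [hv, ENNReal.ofReal_le_coe] at h1
      exact h1

end YoungMeasure

/-! ### Jensen, second moments, and the primal competitor -/

section Primal

variable {d : ℕ} {ν : TimeSpace → EuclideanSpace ℝ (Fin d)} {f : TimeSpace → ℝ × ℝ → ℝ≥0}
  {c : P2 → ℝ≥0} {ρ₀ : P2} {D : ℝ}

/-- Jensen's inequality for the cost. -/
theorem cost_barycentre_le
    (hF_lsc : LowerSemicontinuous fun q : TimeSpace × (ℝ × ℝ) => cost ν f q.1 q.2) (z : TimeSpace)
    (hconv : ConvexOn ℝ (controlSet (ν z)) fun p => (f z p : ℝ)) (κ : Measure (ℝ × ℝ))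
    [IsProbabilityMeasure κ] (h1 : Integrable (fun p : ℝ × ℝ => p.1) κ)
    (h2 : Integrable (fun p : ℝ × ℝ => p.2) κ) :
    cost ν f z (∫ p, p.1 ∂κ, ∫ p, p.2 ∂κ) ≤ ∫⁻ p, cost ν f z p ∂κ := by
  rcases eq_or_ne (∫⁻ p, cost ν f z p ∂κ) ⊤ with htop | htop
  · rw [htop]; exact le_top
  have hlsc : LowerSemicontinuous (cost ν f z) := fun p y hy =>
    (by fun_prop : Continuous fun p : ℝ × ℝ => (z, p)).continuousAt.eventually (hF_lsc (z, p) y hy)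
  -- The epigraph of the cost is closed by lower semicontinuity and convex by convexity of `f`, so
  -- it contains the mean of `(p, F(p))`. Heights are kept nonnegative because `ENNReal.ofReal`
  -- forgets the sign.
  let S : Set ((ℝ × ℝ) × ℝ) := {x | cost ν f z x.1 ≤ ENNReal.ofReal x.2} ∩ {x | 0 ≤ x.2}
  have hSclosed : IsClosed S := by
    refine IsClosed.inter ?_ (isClosed_le continuous_const continuous_snd)
    exact hlsc.isClosed_epigraph.preimage
      (continuous_fst.prodMk (ENNReal.continuous_ofReal.comp continuous_snd))
  have hmem : ∀ x, x ∈ S ↔ x.1 ∈ controlSet (ν z) ∧ (f z x.1 : ℝ) ≤ x.2 := by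
    intro x
    simp only [S, Set.mem_inter_iff, Set.mem_ofPred_eq, cost]
    split_ifs with hx
    · refine ⟨fun h => ⟨hx, ?_⟩, fun h => ⟨?_, (f z x.1).coe_nonneg.trans h.2⟩⟩
      · rw [← ENNReal.ofReal_coe_nnreal] at h
        exact (ENNReal.ofReal_le_ofReal_iff h.2).1 h.1
      · rw [← ENNReal.ofReal_coe_nnreal]
        exact ENNReal.ofReal_le_ofReal h.2
    · simp [hx]
  have hSconv : Convex ℝ S := by
    intro x hx y hy a b ha hb hab
    rw [hmem] at hx hy ⊢
    refine ⟨hconv.1 hx.1 hy.1 ha hb hab, (hconv.2 hx.1 hy.1 ha hb hab).trans ?_⟩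
    exact add_le_add (mul_le_mul_of_nonneg_left hx.2 ha) (mul_le_mul_of_nonneg_left hy.2 hb)
  have hF : Integrable (fun p => (cost ν f z p).toReal) κ :=
    integrable_toReal_of_lintegral_ne_top hlsc.measurable.aemeasurable htop
  have hfin : ∀ᵐ p ∂κ, cost ν f z p < ⊤ := ae_lt_top hlsc.measurable htop
  have hint := hSconv.integral_mem hSclosed (μ := κ)
    (f := fun p => ((p.1, p.2), (cost ν f z p).toReal))
    (hfin.mono fun p hp => ⟨by simp [ENNReal.ofReal_toReal hp.ne], ENNReal.toReal_nonneg⟩)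
    ((h1.prodMk h2).prodMk hF)
  rw [integral_pair (h1.prodMk h2) hF, integral_pair h1 h2] at hint
  refine hint.1.trans (le_of_eq ?_)
  change ENNReal.ofReal (∫ p, (cost ν f z p).toReal ∂κ) = _
  rw [integral_toReal hlsc.measurable.aemeasurable hfin, ENNReal.ofReal_toReal htop]

/-- The barycentric projection of a measure on controls does not increase the cost. -/
theorem exists_barycentric_projection
    (hF_lsc : LowerSemicontinuous fun q : TimeSpace × (ℝ × ℝ) => cost ν f q.1 q.2)
    (hconv : ∀ z, ConvexOn ℝ (controlSet (ν z)) fun p => (f z p : ℝ))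
    (π : Measure (TimeSpace × (ℝ × ℝ))) [IsFiniteMeasure π]
    (h1 : Integrable (fun q => q.2.1) π) (h2 : Integrable (fun q => q.2.2) π) :
    ∃ b a : TimeSpace → ℝ, Integrable b π.fst ∧ Integrable a π.fst ∧
      (∀ φ : TestFun, ∫ q, φ.generator q.1 q.2 ∂π = ∫ z, φ.generator z (b z, a z) ∂π.fst) ∧
      ∫⁻ z, cost ν f z (b z, a z) ∂π.fst ≤ ∫⁻ q, cost ν f q.1 q.2 ∂π := by
  refine ⟨fun z => ∫ p, p.1 ∂π.condKernel z, fun z => ∫ p, p.2 ∂π.condKernel z,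
    h1.integral_condKernel, h2.integral_condKernel, fun φ => ?_, ?_⟩
  · have hg : Integrable (fun q : TimeSpace × (ℝ × ℝ) => φ.generator q.1 q.2) π := by
      have hm (g : C₀(TimeSpace, ℝ)) {u : TimeSpace × (ℝ × ℝ) → ℝ} (hu : Integrable u π) :
          Integrable (fun q => g q.1 * u q) π :=
        hu.bdd_mul (c := ‖g.toBCF‖)
          (g.continuous.comp continuous_fst).measurable.aestronglyMeasurable
          (ae_of_all _ fun q => g.toBCF.norm_coe_le_norm q.1)
      have h0 : Integrable (fun q => φ.dt q.1) π := by
        simpa using hm φ.dt (integrable_const (1 : ℝ))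
      simp_rw [TestFun.generator, mul_assoc (1 / 2 : ℝ)]
      exact (h0.add (hm φ.dx h1)).add ((hm φ.dxx h2).const_mul _)
    rw [← Measure.integral_condKernel hg]
    refine integral_congr_ae ?_
    filter_upwards [h1.condKernel_ae, h2.condKernel_ae] with z hz1 hz2
    simp only [TestFun.generator]
    simp_rw [add_assoc]
    have hz12 : Integrable (fun p : ℝ × ℝ => φ.dx z * p.1 + 1 / 2 * φ.dxx z * p.2)
        (π.condKernel z) := (hz1.const_mul _).add (hz2.const_mul _)
    rw [integral_add (integrable_const _) hz12,
      integral_add (hz1.const_mul _) (hz2.const_mul _), integral_const_mul, integral_const_mul]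
    simp
  · rw [← Measure.lintegral_condKernel hF_lsc.measurable]
    refine lintegral_mono_ae ?_
    filter_upwards [h1.condKernel_ae, h2.condKernel_ae] with z hz1 hz2
    exact cost_barycentre_le hF_lsc z (hconv z) _ hz1 hz2

/-- The factor `1 + (1 - t)` contributes `-ψ`, which absorbs the `ψ` produced by Young's inequality
from `ψ₁² ≤ 4 ψ`. The bound is therefore uniform in `κ`, and no Grönwall argument is needed. -/
theorem truncSq_localize_generator_le {κ : ℝ} (hκ : 0 < κ) (z : TimeSpace) (p : ℝ × ℝ) :
    ((0 : TestFun).localize (truncSq κ hκ) 0 1 1).generator z p ≤ 6 * (|p.1| ^ 2 + |p.2|) := by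
  rw [TestFun.localize_generator]
  set u := invQuad κ z.2
  have hu0 : 0 < u := invQuad_pos κ z.2
  have hu1 : u ≤ 1 := invQuad_le_one κ z.2
  set ψ := (truncSq κ hκ).toFun z.2 with hψ
  set ψ₁ := (truncSq κ hκ).d1 z.2 with hψ₁
  set ψ₂ := (truncSq κ hκ).d2 z.2 with hψ₂
  have e0 : ψ = z.2 ^ 2 * u ^ 2 := rfl
  have e1 : ψ₁ = 2 * z.2 * u ^ 2 * (2 * u - 1) := rfl
  have d1 : ψ₁ ^ 2 ≤ 4 * ψ := by
    have h1 : (u * (2 * u - 1)) ^ 2 ≤ 1 := by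
      rw [sq_le_one_iff_abs_le_one, abs_mul, abs_of_pos hu0]
      exact mul_le_one₀ hu1 (abs_nonneg _) (abs_le.2 ⟨by linarith, by linarith⟩)
    have h2 := mul_le_mul_of_nonneg_left h1 (by positivity : 0 ≤ 4 * (z.2 ^ 2 * u ^ 2))
    rw [e0, e1]
    linarith
  have d2 : |ψ₂| ≤ 6 := (abs_truncSq_d2_le κ z.2).trans (by linarith)
  set H := 0 * (0 : TestFun).toFun z + 1 + 1 * (1 - (z.1 : ℝ)) with hH
  have hH1 : |H| ≤ 2 := by
    have := z.1.2.1
    have := z.1.2.2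
    rw [hH, abs_le]; constructor <;> linarith
  have t1 : ψ₁ * (H * p.1) ≤ ψ + 4 * |p.1| ^ 2 := by
    have h1 : ψ₁ * (H * p.1) ≤ |ψ₁| * (2 * |p.1|) := by
      refine (le_abs_self _).trans ?_
      rw [abs_mul, abs_mul]; gcongr
    have h2 := sq_nonneg (|ψ₁| - 4 * |p.1|)
    have h3 : |ψ₁| ^ 2 = ψ₁ ^ 2 := sq_abs _
    nlinarith
  have t2 : 1 / 2 * ψ₂ * H * p.2 ≤ 6 * |p.2| := by
    refine (le_abs_self _).trans ?_
    rw [abs_mul, abs_mul, abs_mul, abs_of_pos (by norm_num : (0 : ℝ) < 1 / 2)]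
    calc 1 / 2 * |ψ₂| * |H| * |p.2| ≤ 1 / 2 * 6 * 2 * |p.2| := by gcongr
      _ = _ := by ring
  have t3 : 0 ≤ |p.1| ^ 2 := by positivity
  linarith

/-- Solutions of the Fokker–Planck equation with square integrable drift and integrable diffusion
propagate finite second moments. -/
theorem FokkerPlanck.integrable_sq {ρ₁ : ProbabilityMeasure ℝ} {ρ : FiniteMeasure TimeSpace}
    {B A : SignedMeasure TimeSpace} (h : FokkerPlanck ρ₀.meas (ρ₁ : Measure ℝ) ρ B A)
    (hB : B.totalVariation ≪ (ρ : Measure TimeSpace))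
    (hA : A.totalVariation ≪ (ρ : Measure TimeSpace))
    (hint : ∫⁻ z, ENNReal.ofReal (|B.rnDeriv (ρ : Measure TimeSpace) z| ^ 2
        + |A.rnDeriv (ρ : Measure TimeSpace) z|) ∂(ρ : Measure TimeSpace) < ⊤) :
    Integrable (fun x : ℝ => x ^ 2) (ρ₁ : Measure ℝ) := by
  set b := B.rnDeriv (ρ : Measure TimeSpace)
  set a := A.rnDeriv (ρ : Measure TimeSpace)
  have hbm : Measurable b := SignedMeasure.measurable_rnDeriv B _
  have ham : Measurable a := SignedMeasure.measurable_rnDeriv A _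
  have hR : Integrable (fun z => |b z| ^ 2 + |a z|) (ρ : Measure TimeSpace) := by
    refine ⟨(by fun_prop : Measurable fun z => |b z| ^ 2 + |a z|).aestronglyMeasurable, ?_⟩
    rw [hasFiniteIntegral_iff_ofReal (ae_of_all _ fun z => by positivity)]
    exact hint
  let κ : ℕ → ℝ := fun n => 1 / ((n : ℝ) + 1)
  have hκ : ∀ n, 0 < κ n := fun n => Nat.one_div_pos_of_nat
  have hlim : Tendsto κ atTop (𝓝 0) := tendsto_one_div_add_atTop_nhds_zero_nat
  let ψ : ℕ → ℝ →ᵇ ℝ := fun n => (truncSq (κ n) (hκ n)).toFun.toBCF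
  have hψ : ∀ n x, ψ n x = x ^ 2 * invQuad (κ n) x ^ 2 := fun n x => rfl
  set M := 2 * ∫ x, x ^ 2 ∂ρ₀.meas + 6 * ∫ z, (|b z| ^ 2 + |a z|) ∂(ρ : Measure TimeSpace) with hM
  have hbound : ∀ n, ∫ x, ψ n x ∂(ρ₁ : Measure ℝ) ≤ M := by
    intro n
    set φ := (0 : TestFun).localize (truncSq (κ n) (hκ n)) 0 1 1
    have hfp := h.integral_generator_eq hB hA φ
    have s1 : ∫ x, φ.slice 1 x ∂(ρ₁ : Measure ℝ) = ∫ x, ψ n x ∂(ρ₁ : Measure ℝ) := by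
      refine integral_congr_ae (ae_of_all _ fun x => ?_)
      change ψ n x * (0 * 0 + 1 + 1 * (1 - ((1 : unitInterval) : ℝ))) = ψ n x
      simp
    have s0 : ∫ x, φ.slice 0 x ∂ρ₀.meas ≤ 2 * ∫ x, x ^ 2 ∂ρ₀.meas := by
      rw [← integral_const_mul]
      refine integral_mono (BoundedContinuousFunction.integrable _ _) (ρ₀.2.const_mul 2) fun x => ?_
      change ψ n x * (0 * 0 + 1 + 1 * (1 - ((0 : unitInterval) : ℝ))) ≤ 2 * x ^ 2
      have e1 : invQuad (κ n) x ^ 2 ≤ 1 := pow_le_one₀ (invQuad_pos _ _).le (invQuad_le_one _ _)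
      have e2 := mul_le_mul_of_nonneg_left e1 (sq_nonneg x)
      rw [hψ, Set.Icc.coe_zero]
      linarith
    have s2 : ∫ z, φ.generator z (b z, a z) ∂(ρ : Measure TimeSpace)
        ≤ 6 * ∫ z, (|b z| ^ 2 + |a z|) ∂(ρ : Measure TimeSpace) := by
      rw [← integral_const_mul]
      exact integral_mono (integrable_generator φ (SignedMeasure.integrable_rnDeriv B _)
        (SignedMeasure.integrable_rnDeriv A _)) (hR.const_mul 6)
        fun z => truncSq_localize_generator_le (hκ n) z (b z, a z)
    linarith
  have hlint : ∫⁻ x, ENNReal.ofReal (x ^ 2) ∂(ρ₁ : Measure ℝ) ≤ ENNReal.ofReal M := by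
    have hpt : ∀ x : ℝ, ENNReal.ofReal (x ^ 2)
        = liminf (fun n => ENNReal.ofReal (ψ n x)) atTop := fun x => by
      have : Tendsto (fun n => ENNReal.ofReal (ψ n x)) atTop (𝓝 (ENNReal.ofReal (x ^ 2))) := by
        refine (ENNReal.continuous_ofReal.tendsto _).comp ?_
        simpa [hψ] using ((tendsto_invQuad_one x hlim).pow 2).const_mul (x ^ 2)
      exact this.liminf_eq.symm
    simp_rw [hpt]
    refine (lintegral_liminf_le fun n => (ψ n).continuous.measurable.ennreal_ofReal).trans ?_
    refine liminf_le_of_le (by isBoundedDefault) fun y hy => ?_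
    obtain ⟨n, hn⟩ := hy.exists
    refine hn.trans ?_
    rw [← ofReal_integral_eq_lintegral_ofReal ((ψ n).integrable _)
      (ae_of_all _ fun x => by rw [hψ]; positivity)]
    exact ENNReal.ofReal_le_ofReal (hbound n)
  refine ⟨(by fun_prop : Continuous fun x : ℝ => x ^ 2).aestronglyMeasurable, ?_⟩
  rw [hasFiniteIntegral_iff_ofReal (ae_of_all _ fun x => sq_nonneg x)]
  exact hlint.trans_lt ENNReal.ofReal_lt_top

/-- A primal competitor whose objective is at most the dual value. -/
theorem exists_feasible_objective_le
    (hF_lsc : LowerSemicontinuous fun q : TimeSpace × (ℝ × ℝ) => cost ν f q.1 q.2)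
    (hconv : ∀ z, ConvexOn ℝ (controlSet (ν z)) fun p => (f z p : ℝ))
    (hF_coer : IsCoerciveCost (cost ν f)) (hF_int : HasSquareIntegrableControls (cost ν f) ρ₀)
    (hC_conv : IsConvexPenalty c) (hC_cont : Continuous c)
    (hD : dualValue ν (cost ν f) c ρ₀ ≤ (D : EReal)) :
    ∃ q ∈ feasible ρ₀, objective (cost ν f) c q ≤ ENNReal.ofReal D := by
  obtain ⟨w, K, hw⟩ := hF_coer.exists_isCostWeight
  obtain ⟨π, ρ₁, hπ, hi1, hi2, hFP, hcost⟩ := exists_controlMeasure hw hF_lsc hD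
  obtain ⟨b, a, hb, ha, hgen, hJ⟩ := exists_barycentric_projection hF_lsc hconv π hi1 hi2
  let ρ : FiniteMeasure TimeSpace := ⟨π.fst, inferInstance⟩
  let B : SignedMeasure TimeSpace := π.fst.withDensityᵥ b
  let A : SignedMeasure TimeSpace := π.fst.withDensityᵥ a
  have hB : B.totalVariation ≪ (ρ : Measure TimeSpace) :=
    withDensityᵥ_totalVariation_absolutelyContinuous _ _
  have hA : A.totalVariation ≪ (ρ : Measure TimeSpace) :=
    withDensityᵥ_totalVariation_absolutelyContinuous _ _
  have hBd : B.rnDeriv (ρ : Measure TimeSpace) =ᵐ[π.fst] b := rnDeriv_withDensityᵥ hb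
  have hAd : A.rnDeriv (ρ : Measure TimeSpace) =ᵐ[π.fst] a := rnDeriv_withDensityᵥ ha
  have hfp : FokkerPlanck ρ₀.meas (ρ₁ : Measure ℝ) ρ B A := by
    intro φ
    rw [hFP, hgen, integral_generator φ hb ha, sintegral_eq_integral_rnDeriv hB,
      sintegral_eq_integral_rnDeriv hA]
    have e1 : ∫ z, φ.dx z * B.rnDeriv (ρ : Measure TimeSpace) z ∂(ρ : Measure TimeSpace)
        = ∫ z, φ.dx z * b z ∂π.fst :=
      integral_congr_ae (hBd.mono fun z hz => by simp only [hz])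
    have e2 : ∫ z, φ.dxx z * A.rnDeriv (ρ : Measure TimeSpace) z ∂(ρ : Measure TimeSpace)
        = ∫ z, φ.dxx z * a z ∂π.fst :=
      integral_congr_ae (hAd.mono fun z hz => by simp only [hz])
    rw [e1, e2]
    exact sub_self _
  have hrun : runningCost (cost ν f) ρ B A ≤ ∫⁻ q, cost ν f q.1 q.2 ∂π := by
    rw [runningCost, if_pos ⟨hB, hA⟩]
    refine le_trans (le_of_eq ?_) hJ
    refine lintegral_congr_ae ?_
    filter_upwards [hBd, hAd] with z hz1 hz2
    rw [hz1, hz2]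
  have hfin : runningCost (cost ν f) ρ B A < ⊤ :=
    -- The pair `r = 0`, `t = 0` is admissible since the penalty is nonnegative. This bounds the
    -- cost before `ρ₁` is known to have a second moment.
    hrun.trans_lt ((hcost 0 0 fun μ => by simp).2.trans_lt ENNReal.ofReal_lt_top)
  have hsq := hfp.integrable_sq hB hA (hF_int ρ B A ρ₁ hfp hfin)
  let μ₁ : P2 := ⟨ρ₁, hsq⟩
  refine ⟨(ρ, B, A, μ₁), hfp, ?_⟩
  have hε : ∀ ε : ℝ, 0 < ε →
      (runningCost (cost ν f) ρ B A).toReal + c μ₁ ≤ D + ε := by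
    intro ε hε
    obtain ⟨r, τ, hr, hr₁⟩ := hC_conv.exists_affine_minorant hC_cont μ₁ hε
    -- The minorant `∫ r dμ - τ ≤ c μ` is precisely admissibility of `(-r, τ)`; near-equality at
    -- `ρ₁` turns the cost bound into one for cost plus penalty, up to `ε`.
    obtain ⟨h0, hle⟩ := hcost (-r) τ fun μ => by
      have := hr μ
      simp only [BoundedContinuousFunction.coe_neg, Pi.neg_apply, integral_neg]
      linarith
    have h1 := ENNReal.toReal_mono ENNReal.ofReal_ne_top (hrun.trans hle)
    rw [ENNReal.toReal_ofReal h0] at h1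
    simp only [BoundedContinuousFunction.coe_neg, Pi.neg_apply, integral_neg] at h1
    change _ ≤ ∫ x, r x ∂(ρ₁ : Measure ℝ) - τ at hr₁
    linarith
  have hle := le_of_forall_pos_le_add hε
  change runningCost (cost ν f) ρ B A + c μ₁ ≤ _
  rw [← ENNReal.ofReal_toReal hfin.ne, ← ENNReal.ofReal_coe_nnreal,
    ← ENNReal.ofReal_add ENNReal.toReal_nonneg (c μ₁).coe_nonneg]
  exact ENNReal.ofReal_le_ofReal hle

end Primal

end PortfolioTransport

end

theorem theorem1 {d : ℕ}
    (drift : TimeSpace → EuclideanSpace ℝ (Fin d))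
    (cov : TimeSpace → Matrix (Fin d) (Fin d) ℝ) (hcov : ∀ z, (cov z).PosDef)
    (ν : TimeSpace → EuclideanSpace ℝ (Fin d)) (hν : ν = marketPriceOfRisk drift cov)
    (f : TimeSpace → ℝ × ℝ → ℝ≥0)
    (F : TimeSpace → ℝ × ℝ → ℝ≥0∞) (hF : F = cost ν f)
    (ρ₀ ρbar₁ : P2) (C : P2 → P2 → ℝ≥0)
    (hF_lsc : LowerSemicontinuous fun q : TimeSpace × (ℝ × ℝ) => F q.1 q.2)
    (hF_conv : ∀ z, StrictConvexOn ℝ (controlSet (ν z)) fun p => (f z p : ℝ))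
    (hF_coer : IsCoerciveCost F)
    (hF_int : HasSquareIntegrableControls F ρ₀)
    (hC_conv : IsConvexPenalty fun ρ₁ => C ρ₁ ρbar₁)
    (hC_zero : ∀ ρ₁, C ρ₁ ρbar₁ = 0 ↔ ρ₁ = ρbar₁)
    (hC_cont : Continuous fun ρ₁ => C ρ₁ ρbar₁) :
    ((primalValue F (fun ρ₁ => C ρ₁ ρbar₁) ρ₀ : ℝ≥0∞) : EReal)
        = dualValue ν F (fun ρ₁ => C ρ₁ ρbar₁) ρ₀
      ∧ (primalValue F (fun ρ₁ => C ρ₁ ρbar₁) ρ₀ ≠ ⊤ →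
          ∃ q ∈ feasible ρ₀,
            objective F (fun ρ₁ => C ρ₁ ρbar₁) q
              = primalValue F (fun ρ₁ => C ρ₁ ρbar₁) ρ₀) := by
  subst hF
  set c : P2 → ℝ≥0 := fun ρ₁ => C ρ₁ ρbar₁
  set V := primalValue (cost ν f) c ρ₀
  set E := dualValue ν (cost ν f) c ρ₀ with hE
  obtain ⟨w, K, hw⟩ := hF_coer.exists_isCostWeight
  have hE0 : 0 ≤ E := by
    by_contra! h
    obtain ⟨D, hED, hD0⟩ := EReal.lt_iff_exists_real_btwn.1 h
    have := nonneg_of_dualValue_le hw hED.le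
    exact absurd (EReal.coe_lt_coe_iff.1 hD0) (not_lt.2 this)
  have hweak : E.toENNReal ≤ V := by
    refine le_iInf₂ fun q hq => ?_
    have h1 := dualValue_le_objective (ν := ν) (f := f) c ρ₀ hq
    rw [← EReal.coe_ennreal_le_coe_ennreal_iff, EReal.coe_toENNReal hE0]
    exact h1
  -- A competitor at the exact dual level both closes the gap and will be the minimizer, so no
  -- minimizing sequence is needed.
  have hstrong : E ≠ ⊤ → ∃ q ∈ feasible ρ₀, objective (cost ν f) c q ≤ E.toENNReal := by
    intro hEtop
    have hreal : ((E.toReal : ℝ) : EReal) = E :=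
      EReal.coe_toReal hEtop (ne_bot_of_le_ne_bot EReal.zero_ne_bot hE0)
    obtain ⟨q, hq, hle⟩ := exists_feasible_objective_le (D := E.toReal) hF_lsc
      (fun z => (hF_conv z).convexOn) hF_coer hF_int hC_conv hC_cont hreal.ge
    refine ⟨q, hq, hle.trans (le_of_eq ?_)⟩
    rw [EReal.toENNReal, if_neg hEtop]
  have heq : V = E.toENNReal := by
    refine le_antisymm ?_ hweak
    rcases eq_or_ne E ⊤ with htop | htop
    · rw [htop, EReal.toENNReal_top]; exact le_top
    · obtain ⟨q, hq, hle⟩ := hstrong htop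
      exact (iInf₂_le q hq).trans hle
  refine ⟨by rw [heq, EReal.coe_toENNReal hE0], fun hV => ?_⟩
  have hEtop : E ≠ ⊤ := fun h => hV (by rw [heq, h, EReal.toENNReal_top])
  obtain ⟨q, hq, hle⟩ := hstrong hEtop
  exact ⟨q, hq, le_antisymm (hle.trans heq.ge) (iInf₂_le q hq)⟩
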